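/- **Theorem (regret of Consensus-UCB).** Let $G=(V,E)$ be a finite connected undirected graph with $M=|V|$ vertices (agents), Laplacian $L$ and maximum degree $d_{\max}$. Let $\kappa>0$ be such that the consensus matrix $P=I-\kappa d_{\max}^{-1}L$ ($P=I$ if $M=1$) is row stochastic, with eigenvalues $1=\lambda_1\ge\dots\ge\lambda_M>-1$ and a corresponding orthonormal basis of eigenvectors $u_1,\dots,u_M$, $u_p=(u_p^d)_{d\in V}$. For $v\in V$ put $$\omega^{+}_{pj}=\sum_{d\in V}u_p^du_j^d\,\mathbf 1\{u_p^du_j^d\ge 0\},\qquad \omega^{-}_{pj}=\sum_{d\in V}u_p^du_j^d\,\mathbf 1\{u_p^du_j^d\le 0\},\qquad \omega_{pj}=\max(\omega_{pj}^+,|\omega_{pj}^-|),$$ $$a_{pj}(v)=\begin{cases}\omega^+_{pj}\,u_p^vu_j^v & \lambda_p\lambda_j\ge 0,\ u_p^vu_j^v\ge 0,\\ \omega^-_{pj}\,u_p^vu_j^v & \lambda_p\lambda_j\ge 0,\ u_p^vu_j^v< 0,\\ \omega_{pj}\,|u_p^vu_j^v| & \lambda_p\lambda_j<0,\end{cases}\qquad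 a_{pj}=\sum_{v\in V}a_{pj}(v),$$ $$\epsilon=\sqrt M\sum_{p=2}^M\frac{|\lambda_p|}{1-|\lambda_p|},\qquad \epsilon^v=M\sum_{p=1}^M\sum_{j=2}^M\frac{|\lambda_p\lambda_j|}{1-|\lambda_p\lambda_j|}a_{pj}(v),\qquad h(G)=\sum_{p=1}^M\sum_{j=2}^M\frac{|\lambda_p\lambda_j|}{1-|\lambda_p\lambda_j|}a_{pj}=\frac1M\sum_{v\in V}\epsilon^v .$$ The agents face a common $K$-armed stochastic bandit: the rewards of arm $k$ have law $\nu_k$ with mean $\mu_k$ and variance at most $\rho$. In each round $t=1,2,\dots$ every agent $v$ chooses an arm $A_{v,t}$ on the basis of the past and receives a reward drawn from $\nu_{A_{v,t}}$, independently of the past and of the other agents. Let $\zeta_k(t)\in\{0,1\}^V$ be the vector of indicators of the agents that pull arm $k$ in round $t$, and $r_k(t)$ the vector of the rewards they obtain from it. With $\hat s_k(0)=\hat n_k(0)=0$ and $\circ$ the entrywise product, the running consensus estimates are $$\hat s_k(t)=P\bigl(\hat s_k(t-1)+r_k(t)\circ\zeta_k(t)\bigr),\qquad \hat n_k(t)=P\bigl(\hat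 n_k(t-1)+\zeta_k(t)\bigr).$$ Under *Consensus-UCB*, in round $t\le K$ every agent pulls arm $t$, and in every round $t>K$ each agent $v$ pulls an arm $k$ that maximizes (ties broken arbitrarily) $$\frac{\hat s_k^v(t-1)}{\hat n_k^v(t-1)}+\sqrt{\frac{6\rho\,t^{2/3}}{M}\cdot\frac{\hat n_k^v(t-1)+\epsilon^v}{\hat n_k^v(t-1)^2}} .$$ Let $\mu_*=\max_k\mu_k$, $\Delta_k=\mu_*-\mu_k$, and let $R_G(T)=\mu_*TM-\mathbb E\sum_{v\in V}\sum_{t=1}^T\mu_{A_{v,t}}$ be the group regret. Then the following hold. 1. For every $T\ge 0$, $$R_G(T)\le\sum_{k:\Delta_k>0}\Delta_k\left(M+M\epsilon+T^{2/3}\left(6\rho\,\frac{1+h(G)}{\Delta_k^2}+M\right)\right).$$ 2. Consequently $R_G(T)=O\bigl((1+h(G))KT^{2/3}\bigr)$, with a constant that depends only on $M$, $\rho$ and the gaps: if $C\ge 0$ satisfies $6\rho/\Delta_k+2M\Delta_k\le C$ for all $k$ with $\Delta_k>0$, then $R_G(T)\le C\,(1+h(G))\,K\,T^{2/3}$ for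 all $T$ with $T^{2/3}\ge 1+\epsilon$. -/

import Mathlib

open MeasureTheory ProbabilityTheory

noncomputable section

namespace ConsensusBandit

/-! ### The consensus matrix and its spectral constants -/

section Graph

/-- The consensus matrix `P = I - κ d_max⁻¹ L`, where `L` is the graph Laplacian. -/
def consensusMatrix {V : Type*} [Fintype V] [DecidableEq V] (G : SimpleGraph V)
    [DecidableRel G.Adj] (κ : ℝ) : Matrix V V ℝ :=
  1 - (κ * (G.maxDegree : ℝ)⁻¹) • G.lapMatrix ℝ

/-- All indices except the first one (the indices `2, …, M` in one-based numbering). -/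
def tailIndices (M : ℕ) : Finset (Fin M) :=
  Finset.univ.filter fun j => (j : ℕ) ≠ 0

/-- `lam 0 ≥ lam 1 ≥ …` are the eigenvalues of `P`, all larger than `-1`, and `u 0, u 1, …` is a
corresponding orthonormal basis of eigenvectors. (Numbering starts at `0`.) -/
structure IsOrderedEigenbasis {V : Type*} [Fintype V] (P : Matrix V V ℝ)
    (lam : Fin (Fintype.card V) → ℝ)
    (u : OrthonormalBasis (Fin (Fintype.card V)) ℝ (EuclideanSpace ℝ V)) : Prop where
  antitone : Antitone lam
  neg_one_lt : ∀ p, -1 < lam p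
  eigen : ∀ p i, ∑ j, P i j * u p j = lam p * u p i

variable {V : Type*} [Fintype V] (lam : Fin (Fintype.card V) → ℝ)
  (u : OrthonormalBasis (Fin (Fintype.card V)) ℝ (EuclideanSpace ℝ V))

/-- `ω⁺_{pj}`: the sum of the nonnegative products `u_p^d u_j^d`. -/
def omegaPos (p j : Fin (Fintype.card V)) : ℝ :=
  ∑ d : V, if 0 ≤ u p d * u j d then u p d * u j d else 0

/-- `ω⁻_{pj}`: the sum of the nonpositive products `u_p^d u_j^d`. -/
def omegaNeg (p j : Fin (Fintype.card V)) : ℝ :=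
  ∑ d : V, if u p d * u j d ≤ 0 then u p d * u j d else 0

/-- `ω_{pj} = max (ω⁺_{pj}, |ω⁻_{pj}|)`. -/
def omegaMax (p j : Fin (Fintype.card V)) : ℝ :=
  max (omegaPos u p j) |omegaNeg u p j|

/-- The coefficient `a_{pj}(v)` of agent `v`; note `(u_p u_jᵀ)_{vv} = u_p^v u_j^v`. -/
def aCoeff (p j : Fin (Fintype.card V)) (v : V) : ℝ :=
  if 0 ≤ lam p * lam j then
    if 0 ≤ u p v * u j v then omegaPos u p j * (u p v * u j v)
    else omegaNeg u p j * (u p v * u j v)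
  else omegaMax u p j * |u p v * u j v|

/-- The constant `ε^v = M ∑_{p=1}^M ∑_{j=2}^M |λ_p λ_j| / (1 - |λ_p λ_j|) a_{pj}(v)` of agent `v`,
which enters its confidence bound. -/
def agentEps (v : V) : ℝ :=
  (Fintype.card V : ℝ) * ∑ p, ∑ j ∈ tailIndices (Fintype.card V),
    |lam p * lam j| / (1 - |lam p * lam j|) * aCoeff lam u p j v

/-- `h(G) = ∑_{p=1}^M ∑_{j=2}^M |λ_p λ_j| / (1 - |λ_p λ_j|) a_{pj}` with
`a_{pj} = ∑_v a_{pj}(v)`. -/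
def hGraph : ℝ :=
  ∑ p, ∑ j ∈ tailIndices (Fintype.card V),
    |lam p * lam j| / (1 - |lam p * lam j|) * ∑ v, aCoeff lam u p j v

/-- `h(G)` is the average over the agents of the constants `ε^v`. -/
theorem hGraph_eq_average [Nonempty V] :
    hGraph lam u = (∑ v, agentEps lam u v) / (Fintype.card V : ℝ) := by
  have hM : (Fintype.card V : ℝ) ≠ 0 := by
    exact_mod_cast Fintype.card_ne_zero
  have h : ∑ v, agentEps lam u v = (Fintype.card V : ℝ) * hGraph lam u := by
    simp only [agentEps, hGraph, Finset.mul_sum]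
    rw [Finset.sum_comm]
    refine Finset.sum_congr rfl fun p _ => ?_
    rw [Finset.sum_comm]
  rw [h, mul_div_cancel_left₀ _ hM]

/-- `ε = √M ∑_{p=2}^M |λ_p| / (1 - |λ_p|)`. -/
def epsGraph : ℝ :=
  Real.sqrt (Fintype.card V : ℝ) * ∑ p ∈ tailIndices (Fintype.card V), |lam p| / (1 - |lam p|)

end Graph

/-! ### Running consensus and the Consensus-UCB rule, along one trajectory

`a t v` is the arm pulled by agent `v` in round `t = 1, 2, …` and `x t v` the reward received. -/

section Algorithm

variable {V : Type*} [Fintype V] {K : ℕ}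

/-- The indicator vector `ζ_k(t)` of the agents that pull arm `k` in round `t`. -/
def pullVec (a : ℕ → V → Fin K) (k : Fin K) (t : ℕ) : V → ℝ :=
  fun v => if a t v = k then 1 else 0

/-- `ŝ_k(t) = P (ŝ_k(t-1) + r_k(t) ∘ ζ_k(t))`, started at `0`. -/
def sHat (P : Matrix V V ℝ) (a : ℕ → V → Fin K) (x : ℕ → V → ℝ) (k : Fin K) : ℕ → V → ℝ
  | 0 => 0
  | t + 1 => P.mulVec (sHat P a x k t + x (t + 1) * pullVec a k (t + 1))

/-- `n̂_k(t) = P (n̂_k(t-1) + ζ_k(t))`, started at `0`. -/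
def nHat (P : Matrix V V ℝ) (a : ℕ → V → Fin K) (k : Fin K) : ℕ → V → ℝ
  | 0 => 0
  | t + 1 => P.mulVec (nHat P a k t + pullVec a k (t + 1))

/-- The upper confidence bound of agent `v` for arm `k` in round `t + 1`, computed from the
consensus estimates available after round `t`; `e v` is the constant `ε^v`. -/
def ucbIndex (P : Matrix V V ℝ) (ρ : ℝ) (e : V → ℝ) (a : ℕ → V → Fin K) (x : ℕ → V → ℝ)
    (t : ℕ) (v : V) (k : Fin K) : ℝ :=
  sHat P a x k t v / nHat P a k t v +
    √(6 * ρ * ((t + 1 : ℕ) : ℝ) ^ (2 / 3 : ℝ) / (Fintype.card V : ℝ) *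
      ((nHat P a k t v + e v) / nHat P a k t v ^ 2))

/-- The trajectory follows Consensus-UCB: in rounds `1, …, K` every agent pulls each arm once, in
order; afterwards every agent pulls an arm with the largest upper confidence bound (ties are
broken arbitrarily). -/
structure FollowsConsensusUCB (P : Matrix V V ℝ) (ρ : ℝ) (e : V → ℝ) (a : ℕ → V → Fin K)
    (x : ℕ → V → ℝ) : Prop where
  init : ∀ t < K, ∀ v, (a (t + 1) v : ℕ) = t
  argmax : ∀ t, K ≤ t → ∀ v k,
    ucbIndex P ρ e a x t v k ≤ ucbIndex P ρ e a x t v (a (t + 1) v)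

end Algorithm

/-! ### The stochastic environment and the regret -/

section Environment

variable {V Ω : Type*} [Fintype V] [mΩ : MeasurableSpace Ω] {K : ℕ}

/-- Cooperative stochastic bandit with reward laws `ν k`. `X t v k` is the reward that agent `v`
gets in round `t ≥ 1` if it pulls arm `k`; it has law `ν k`, the rewards of one round are
independent of each other and of the past, and the arms `A t v` of round `t` are chosen
on the basis of the past (`ℱ t` is the information available after round `t`; it may contain
additional randomness used for breaking ties). -/
structure IsBanditProcess (μ : Measure Ω) (ν : Fin K → Measure ℝ) (ℱ : Filtration ℕ mΩ)
    (X : ℕ → V → Fin K → Ω → ℝ) (A : ℕ → V → Ω → Fin K) : Prop where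
  measurable_reward : ∀ t v k, Measurable[ℱ (t + 1)] (X (t + 1) v k)
  law_reward : ∀ t v k, μ.map (X (t + 1) v k) = ν k
  indep_round : ∀ t, iIndepFun (fun (i : V × Fin K) => X (t + 1) i.1 i.2) μ
  indep_past : ∀ t,
    Indep (⨆ i : V × Fin K, MeasurableSpace.comap (X (t + 1) i.1 i.2) inferInstance) (ℱ t) μ
  measurable_action : ∀ t v, Measurable[ℱ t] (A (t + 1) v)

/-- The mean `μ_k` of arm `k`. -/
def armMean (ν : Fin K → Measure ℝ) (k : Fin K) : ℝ := ∫ y, y ∂(ν k)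

/-- The gap `Δ_k = μ_* - μ_k`, with `μ_* = max_j μ_j`. -/
def gap (ν : Fin K → Measure ℝ) (k : Fin K) : ℝ := (⨆ j, armMean ν j) - armMean ν k

/-- The (expected) group regret `R(T) = μ_* T M - E ∑_v ∑_{t=1}^T μ_{A_{v,t}}`. -/
def groupRegret (μ : Measure Ω) (ν : Fin K → Measure ℝ) (A : ℕ → V → Ω → Fin K) (T : ℕ) : ℝ :=
  (⨆ j, armMean ν j) * T * (Fintype.card V : ℝ) -
    ∫ ω, ∑ v, ∑ t ∈ Finset.Icc 1 T, armMean ν (A t v ω) ∂μ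

end Environment

end ConsensusBandit

end

/-! The rewards have only a second moment, so concentration comes from a self-normalized Chebyshev
bound; the bonus of order `t^(2/3)` makes the summed failure bounds of order `T^(2/3)`.

The regret is the sum of Δ_k times the expected group pulls of arm k. Fix a suboptimal arm with gap
Δ and put θ = T^(1/3), w = 6ρ/(MΔ²), η = (w + b)θ² with a share b in (0,1). A pull by agent v is
early if n̂^v < η and late otherwise. Expanding powers of P in eigenvectors shows that n̂^v is
within ε of the average number of pulls, so at most M(η + ε) + M pulls are early
(`sum_early_pulls_le`). It remains to show that agent v makes at most θ²(1 - b) + wθ²ε^v late pulls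
in expectation (`exists_late_pulls_bound`): summed over the agents, b cancels and the ε^v add up to
M h(G).

For fixed t, the deviation ŝ - μ n̂ is a sum S of martingale increments with predictable weights,
whose squares sum to V ≤ (n̂ + ε^v)/M (`sum_sq_weights_le`); this is the quantity under the root of
the bonus. If W decreases and Ψ dominates its lower Riemann sums, then E[S² W(V)] ≤ ρ E[Ψ(V)]
(`IsRoundNoise.integral_sq_mul_le`). W = 1/V above a cutoff costs 1 + log t and serves the best arm,
whose count is only known to be at least 1. W proportional to 1/V² above a cutoff costs a constant
and serves the suboptimal arm, whose count is at least η.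

A late pull forces two normalized squared deviations to add up to at least 1 (`one_le_of_index_le`).
Taking expectations and summing over t leaves a deterministic inequality in θ, w, ε^v
(`late_budget`). It needs sharp constants, because the term M T^(2/3) has coefficient one; hence the
piecewise choice of b = `thresholdShare θ`. -/

namespace ConsensusBandit

/-! ### Spectrum of the consensus matrix -/

section Spectral

variable {V : Type*} [Fintype V]

theorem sum_mul_basis (u : OrthonormalBasis (Fin (Fintype.card V)) ℝ (EuclideanSpace ℝ V))
    (p q : Fin (Fintype.card V)) : ∑ i, u p i * u q i = if p = q then 1 else 0 := by
  have h := orthonormal_iff_ite.1 u.orthonormal q p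
  simp only [PiLp.inner_apply, RCLike.inner_apply, conj_trivial] at h
  rw [h]
  simp [eq_comm]

theorem abs_basis_le_one (u : OrthonormalBasis (Fin (Fintype.card V)) ℝ (EuclideanSpace ℝ V))
    (p : Fin (Fintype.card V)) (i : V) : |u p i| ≤ 1 := by
  have h := sum_mul_basis u p p
  rw [if_pos rfl] at h
  have h1 : u p i * u p i ≤ ∑ i, u p i * u p i :=
    Finset.single_le_sum (f := fun i => u p i * u p i) (fun i _ => mul_self_nonneg _)
      (Finset.mem_univ i)
  exact abs_le_one_iff_mul_self_le_one.2 (h1.trans h.le)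

variable [DecidableEq V]

theorem sum_basis_mul (u : OrthonormalBasis (Fin (Fintype.card V)) ℝ (EuclideanSpace ℝ V))
    (i j : V) : ∑ p, u p i * u p j = if i = j then 1 else 0 := by
  have h := u.sum_inner_mul_inner (EuclideanSpace.single i (1 : ℝ)) (EuclideanSpace.single j 1)
  simp only [EuclideanSpace.inner_single_left, EuclideanSpace.inner_single_right, map_one, one_mul,
    conj_trivial] at h
  rw [h]
  simp [eq_comm]

theorem pow_apply_eq_sum {P : Matrix V V ℝ} {lam : Fin (Fintype.card V) → ℝ}
    {u : OrthonormalBasis (Fin (Fintype.card V)) ℝ (EuclideanSpace ℝ V)}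
    (hu : IsOrderedEigenbasis P lam u) (s : ℕ) (i j : V) :
    (P ^ s) i j = ∑ p, lam p ^ s * (u p i * u p j) := by
  have key : ∀ (s : ℕ) p i, ∑ l, (P ^ s) i l * u p l = lam p ^ s * u p i := by
    intro s p
    induction s with
    | zero => intro i; simp [Matrix.one_apply]
    | succ s ih =>
      intro i
      simp only [pow_succ P s, Matrix.mul_apply, Finset.sum_mul]
      rw [Finset.sum_comm]
      have : ∀ l, ∑ x, (P ^ s) i l * P l x * u p x = lam p * ((P ^ s) i l * u p l) := by
        intro l
        rw [show lam p * ((P ^ s) i l * u p l) = (P ^ s) i l * (lam p * u p l) by ring,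
          ← hu.eigen p l, Finset.mul_sum]
        exact Finset.sum_congr rfl fun x _ => by ring
      simp only [this, ← Finset.mul_sum, ih]
      ring
  -- The resolution of the identity in the eigenbasis is inserted on the right of `P ^ s`.
  have h1 : (P ^ s) i j = ∑ l, (P ^ s) i l * ∑ p, u p l * u p j := by
    simp [sum_basis_mul]
  rw [h1]
  simp only [Finset.mul_sum]
  rw [Finset.sum_comm]
  refine Finset.sum_congr rfl fun p _ => ?_
  rw [← mul_assoc, ← key s p i, Finset.sum_mul]
  exact Finset.sum_congr rfl fun l _ => by ring

/-- At a coordinate where |u_p| is largest, an average of the entries of u_p with the weights of a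
row of `P` cannot exceed it in absolute value. -/
theorem eigenvalue_le_one {P : Matrix V V ℝ} (hP : P ∈ Matrix.rowStochastic ℝ V)
    {lam : Fin (Fintype.card V) → ℝ}
    {u : OrthonormalBasis (Fin (Fintype.card V)) ℝ (EuclideanSpace ℝ V)}
    (hu : IsOrderedEigenbasis P lam u) (p : Fin (Fintype.card V)) : lam p ≤ 1 := by
  have : Nonempty V := Fintype.card_pos_iff.1 p.pos
  obtain ⟨i, -, hi⟩ := Finset.exists_max_image Finset.univ (fun i => |u p i|)
    Finset.univ_nonempty
  have hpos : 0 < |u p i| := by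
    by_contra hc
    have h0 : ∀ j, u p j = 0 := fun j =>
      abs_eq_zero.1 (le_antisymm ((hi j (Finset.mem_univ j)).trans (not_lt.1 hc)) (abs_nonneg _))
    have := sum_mul_basis u p p
    simp [h0] at this
  have h1 : |lam p| * |u p i| ≤ |u p i| := by
    rw [← abs_mul, ← hu.eigen p i]
    calc |∑ j, P i j * u p j| ≤ ∑ j, |P i j * u p j| := Finset.abs_sum_le_sum_abs _ _
      _ ≤ ∑ j, P i j * |u p i| := by
          refine Finset.sum_le_sum fun j _ => ?_
          rw [abs_mul, abs_of_nonneg (Matrix.nonneg_of_mem_rowStochastic hP)]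
          exact mul_le_mul_of_nonneg_left (hi j (Finset.mem_univ j))
            (Matrix.nonneg_of_mem_rowStochastic hP)
      _ = |u p i| := by rw [← Finset.sum_mul, Matrix.sum_row_of_mem_rowStochastic hP, one_mul]
  have h2 : |lam p| ≤ 1 := by
    by_contra hc
    nlinarith [not_le.1 hc]
  exact (le_abs_self _).trans h2

variable {G : SimpleGraph V} [DecidableRel G.Adj] {κ : ℝ} {lam : Fin (Fintype.card V) → ℝ}
  {u : OrthonormalBasis (Fin (Fintype.card V)) ℝ (EuclideanSpace ℝ V)}

theorem consensusMatrix_symm (i j : V) : consensusMatrix G κ i j = consensusMatrix G κ j i := by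
  have h := (SimpleGraph.isSymm_lapMatrix (R := ℝ) G).apply i j
  simp only [consensusMatrix, Matrix.sub_apply, Matrix.smul_apply, Matrix.one_apply, h]
  simp [eq_comm]

/-- An eigenvector of the consensus matrix for the eigenvalue `1` is constant. -/
theorem eq_of_eigenvalue_eq_one (hG : G.Connected) (hκ : 0 < κ)
    (hu : IsOrderedEigenbasis (consensusMatrix G κ) lam u) {p : Fin (Fintype.card V)}
    (hp : lam p = 1) (i j : V) : u p i = u p j := by
  -- With maximum degree 0 the Laplacian says nothing, since its coefficient is 0 by `0⁻¹ = 0`; but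
  -- then connectedness leaves a single vertex.
  by_cases hd : G.maxDegree = 0
  · have hij := hG.preconnected i j
    suffices i = j by rw [this]
    obtain ⟨w⟩ := hij
    cases w with
    | nil => rfl
    | cons h _ =>
      have h1 := G.degree_le_maxDegree i
      rw [hd, Nat.le_zero, SimpleGraph.degree_eq_zero] at h1
      exact absurd h (h1 _)
  · have hc : κ * (G.maxDegree : ℝ)⁻¹ ≠ 0 := by positivity
    have h0 : (G.lapMatrix ℝ).mulVec (u p) = 0 := by
      funext i
      have h := hu.eigen p i
      simp only [consensusMatrix, Matrix.sub_apply, Matrix.smul_apply, smul_eq_mul, sub_mul,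
        Finset.sum_sub_distrib, Matrix.one_apply, ite_mul, one_mul, zero_mul,
        Finset.sum_ite_eq, Finset.mem_univ, if_true, hp, mul_assoc _ (G.lapMatrix ℝ _ _),
        ← Finset.mul_sum] at h
      have h2 : κ * (G.maxDegree : ℝ)⁻¹ * ∑ j, G.lapMatrix ℝ i j * u p j = 0 := by linarith
      simpa [Matrix.mulVec, dotProduct] using (mul_eq_zero.1 h2).resolve_left hc
    exact (SimpleGraph.lapMatrix_mulVec_eq_zero_iff_forall_reachable G).1 h0 i j
      (hG.preconnected i j)

theorem basis_mul_of_eigenvalue_eq_one (hG : G.Connected) (hκ : 0 < κ)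
    (hu : IsOrderedEigenbasis (consensusMatrix G κ) lam u) {p : Fin (Fintype.card V)}
    (hp : lam p = 1) (i j : V) : u p i * u p j = 1 / Fintype.card V := by
  have h := sum_mul_basis u p p
  have hc : ∀ l, u p l * u p l = u p i * u p j := fun l => by
    rw [eq_of_eigenvalue_eq_one hG hκ hu hp l i, eq_of_eigenvalue_eq_one hG hκ hu hp j i]
  simp only [hc, Finset.sum_const, Finset.card_univ, nsmul_eq_mul, if_true] at h
  have : (Fintype.card V : ℝ) ≠ 0 := fun h0 => by simp [h0] at h
  field_simp
  linarith

/-- By symmetry the columns of the matrix also sum to one, so an eigenvector for an eigenvalue other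
than 1 has coordinate sum zero. If the largest eigenvalue were below 1, the all-ones vector would be
orthogonal to a whole basis. -/
theorem eigenvalue_zero_eq_one (hP : consensusMatrix G κ ∈ Matrix.rowStochastic ℝ V)
    (hu : IsOrderedEigenbasis (consensusMatrix G κ) lam u) {p : Fin (Fintype.card V)}
    (hp : (p : ℕ) = 0) : lam p = 1 := by
  refine le_antisymm (eigenvalue_le_one hP hu p) ?_
  by_contra hc
  have hlt : ∀ q, lam q < 1 := fun q =>
    (hu.antitone (show p ≤ q from by rw [Fin.le_def, hp]; exact Nat.zero_le _)).trans_lt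
      (not_le.1 hc)
  have horth : ∀ q, ∑ j, u q j = 0 := by
    intro q
    have h1 : ∑ i, ∑ j, consensusMatrix G κ i j * u q j = lam q * ∑ i, u q i := by
      rw [Finset.mul_sum]
      exact Finset.sum_congr rfl fun i _ => hu.eigen q i
    rw [Finset.sum_comm] at h1
    have h2 : ∀ j, ∑ i, consensusMatrix G κ i j * u q j = u q j := fun j => by
      rw [← Finset.sum_mul]
      simp only [consensusMatrix_symm _ j]
      rw [Matrix.sum_row_of_mem_rowStochastic hP, one_mul]
    simp only [h2] at h1
    have : (1 - lam q) * ∑ i, u q i = 0 := by linarith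
    exact (mul_eq_zero.1 this).resolve_left (by linarith [hlt q])
  have : Nonempty V := Fintype.card_pos_iff.1 p.pos
  obtain ⟨i⟩ := ‹Nonempty V›
  have h3 : ∑ j, ∑ q, u q i * u q j = 1 := by simp [sum_basis_mul]
  rw [Finset.sum_comm] at h3
  simp [← Finset.mul_sum, horth] at h3

/-- A second eigenvector for the eigenvalue 1 would be constant like the first one, and two nonzero
constant vectors are not orthogonal. -/
theorem abs_eigenvalue_lt_one (hG : G.Connected) (hκ : 0 < κ)
    (hP : consensusMatrix G κ ∈ Matrix.rowStochastic ℝ V)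
    (hu : IsOrderedEigenbasis (consensusMatrix G κ) lam u) {p : Fin (Fintype.card V)}
    (hp : (p : ℕ) ≠ 0) : |lam p| < 1 := by
  refine abs_lt.2 ⟨hu.neg_one_lt p, lt_of_le_of_ne (eigenvalue_le_one hP hu p) fun h1 => ?_⟩
  let q : Fin (Fintype.card V) := ⟨0, p.pos⟩
  have hq : lam q = 1 := eigenvalue_zero_eq_one hP hu rfl
  have hpq : p ≠ q := fun h => hp (by rw [h])
  have horth := sum_mul_basis u p q
  rw [if_neg hpq] at horth
  have : Nonempty V := Fintype.card_pos_iff.1 p.pos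
  obtain ⟨i⟩ := ‹Nonempty V›
  have hM : (0 : ℝ) < Fintype.card V := by exact_mod_cast p.pos
  have hc : ∀ l, u p l * u q l = u p i * u q i := fun l => by
    rw [eq_of_eigenvalue_eq_one hG hκ hu h1 l i, eq_of_eigenvalue_eq_one hG hκ hu hq l i]
  simp only [hc, Finset.sum_const, Finset.card_univ, nsmul_eq_mul] at horth
  have h2 := basis_mul_of_eigenvalue_eq_one hG hκ hu h1 i i
  have h3 := basis_mul_of_eigenvalue_eq_one hG hκ hu hq i i
  have h4 := (mul_eq_zero.1 horth).resolve_left hM.ne'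
  have h5 : (u p i * u p i) * (u q i * u q i) = 0 := by
    rw [show (u p i * u p i) * (u q i * u q i) = (u p i * u q i) * (u p i * u q i) by ring, h4,
      mul_zero]
  rw [h2, h3] at h5
  have : (0 : ℝ) < 1 / Fintype.card V * (1 / Fintype.card V) := by positivity
  linarith

theorem abs_eigenvalue_le_one (hP : consensusMatrix G κ ∈ Matrix.rowStochastic ℝ V)
    (hu : IsOrderedEigenbasis (consensusMatrix G κ) lam u) (p : Fin (Fintype.card V)) :
    |lam p| ≤ 1 :=
  abs_le.2 ⟨(hu.neg_one_lt p).le, eigenvalue_le_one hP hu p⟩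

end Spectral

/-! ### Geometric sums and the coefficients a_pj(v) -/

section Coefficients

variable {V : Type*} [Fintype V]

/-- The exponents are t, …, 1 and never 0, because a pull is mixed at least once before it is used;
hence the numerator q. -/
theorem sum_range_pow_sub_le {q : ℝ} (h0 : 0 ≤ q) (h1 : q < 1) (t : ℕ) :
    ∑ i ∈ Finset.range t, q ^ (t - i) ≤ q / (1 - q) := by
  have h : ∀ t : ℕ, ∑ i ∈ Finset.range t, q ^ (t - i) = (q - q ^ (t + 1)) / (1 - q) := by
    intro t
    have h2 : 1 - q ≠ 0 := by linarith
    induction t with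
    | zero => simp
    | succ t ih =>
      rw [Finset.sum_range_succ']
      simp only [Nat.add_sub_add_right, Nat.sub_zero, ih]
      field_simp
      ring
  rw [h]
  exact div_le_div_of_nonneg_right (by linarith [pow_nonneg h0 (t + 1)]) (by linarith)

theorem mem_tailIndices {M : ℕ} {j : Fin M} : j ∈ tailIndices M ↔ (j : ℕ) ≠ 0 := by
  simp [tailIndices]

variable (lam : Fin (Fintype.card V) → ℝ)
  (u : OrthonormalBasis (Fin (Fintype.card V)) ℝ (EuclideanSpace ℝ V))

theorem omegaPos_nonneg (p j : Fin (Fintype.card V)) : 0 ≤ omegaPos u p j :=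
  Finset.sum_nonneg fun d _ => by split_ifs with h <;> simp [h]

theorem omegaNeg_nonpos (p j : Fin (Fintype.card V)) : omegaNeg u p j ≤ 0 :=
  Finset.sum_nonpos fun d _ => by split_ifs with h <;> simp [h]

theorem aCoeff_nonneg (p j : Fin (Fintype.card V)) (v : V) : 0 ≤ aCoeff lam u p j v := by
  unfold aCoeff
  split_ifs with h1 h2
  · exact mul_nonneg (omegaPos_nonneg u p j) h2
  · exact mul_nonneg_of_nonpos_of_nonpos (omegaNeg_nonpos u p j) (not_le.1 h2).le
  · exact mul_nonneg (le_max_of_le_left (omegaPos_nonneg u p j)) (abs_nonneg _)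

theorem sum_mul_le_omegaPos (p j : Fin (Fintype.card V)) {z : V → ℝ}
    (hz : ∀ d, z d = 0 ∨ z d = 1) : ∑ d, u p d * u j d * z d ≤ omegaPos u p j := by
  refine Finset.sum_le_sum fun d _ => ?_
  rcases hz d with h | h <;> split_ifs with h2 <;> simp only [h, mul_zero, mul_one]
  · exact h2
  · exact le_rfl
  · exact le_rfl
  · exact (not_le.1 h2).le

theorem omegaNeg_le_sum_mul (p j : Fin (Fintype.card V)) {z : V → ℝ}
    (hz : ∀ d, z d = 0 ∨ z d = 1) : omegaNeg u p j ≤ ∑ d, u p d * u j d * z d := by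
  refine Finset.sum_le_sum fun d _ => ?_
  rcases hz d with h | h <;> split_ifs with h2 <;> simp only [h, mul_zero, mul_one]
  · exact h2
  · exact le_rfl
  · exact le_rfl
  · exact (not_le.1 h2).le

/-- The cases of `aCoeff` are worst cases over all pull patterns z. If λ_p λ_j ≥ 0, the sign of
u_p^v u_j^v decides whether the largest value ω⁺ or the smallest value ω⁻ of the sum is the bad one.
If λ_p λ_j < 0, the sign of the power alternates with s and ω covers both. -/
theorem pow_mul_sum_le_aCoeff (p j : Fin (Fintype.card V)) (v : V) (s : ℕ) {z : V → ℝ}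
    (hz : ∀ d, z d = 0 ∨ z d = 1) :
    (lam p * lam j) ^ s * ((u p v * u j v) * ∑ d, u p d * u j d * z d) ≤
      |lam p * lam j| ^ s * aCoeff lam u p j v := by
  have hP := sum_mul_le_omegaPos u p j hz
  have hN := omegaNeg_le_sum_mul u p j hz
  have h0 : 0 ≤ |lam p * lam j| ^ s := pow_nonneg (abs_nonneg _) _
  unfold aCoeff
  split_ifs with h1 h2
  · rw [abs_of_nonneg h1, mul_comm (omegaPos u p j)]
    exact mul_le_mul_of_nonneg_left (mul_le_mul_of_nonneg_left hP h2) (pow_nonneg h1 _)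
  · rw [abs_of_nonneg h1, mul_comm (omegaNeg u p j)]
    exact mul_le_mul_of_nonneg_left (mul_le_mul_of_nonpos_left hN (not_le.1 h2).le)
      (pow_nonneg h1 _)
  · refine (le_abs_self _).trans ?_
    rw [abs_mul, abs_mul, abs_pow, mul_comm (omegaMax u p j)]
    refine mul_le_mul_of_nonneg_left (mul_le_mul_of_nonneg_left ?_ (abs_nonneg _)) h0
    refine abs_le.2 ⟨?_, hP.trans (le_max_left _ _)⟩
    have := (neg_abs_le (omegaNeg u p j)).trans hN
    have h3 : |omegaNeg u p j| ≤ omegaMax u p j := le_max_right _ _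
    linarith

end Coefficients

/-! ### Running consensus along one trajectory -/

section Trajectory

variable {V : Type*} {K : ℕ}

/-- The number of pulls of arm `k` by all agents in the rounds `1, …, t`. -/
def totalPulls [Fintype V] (a : ℕ → V → Fin K) (k : Fin K) (t : ℕ) : ℝ :=
  ∑ i ∈ Finset.range t, ∑ d, pullVec a k (i + 1) d

theorem pullVec_eq (a : ℕ → V → Fin K) (k : Fin K) (t : ℕ) (d : V) :
    pullVec a k t d = 0 ∨ pullVec a k t d = 1 := by
  unfold pullVec
  split_ifs <;> simp

theorem pullVec_nonneg (a : ℕ → V → Fin K) (k : Fin K) (t : ℕ) (d : V) :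
    0 ≤ pullVec a k t d := by
  rcases pullVec_eq a k t d with h | h <;> simp [h]

theorem pullVec_le_one (a : ℕ → V → Fin K) (k : Fin K) (t : ℕ) (d : V) :
    pullVec a k t d ≤ 1 := by
  rcases pullVec_eq a k t d with h | h <;> simp [h]

theorem pullVec_sq (a : ℕ → V → Fin K) (k : Fin K) (t : ℕ) (d : V) :
    pullVec a k t d ^ 2 = pullVec a k t d := by
  rcases pullVec_eq a k t d with h | h <;> simp [h]

variable [Fintype V] [DecidableEq V] {P : Matrix V V ℝ}

/-- A pull in round i + 1 has been multiplied by `P` exactly t - i times after round t. -/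
theorem nHat_eq_sum (a : ℕ → V → Fin K) (k : Fin K) (t : ℕ) (v : V) :
    nHat P a k t v = ∑ i ∈ Finset.range t, ∑ d, (P ^ (t - i)) v d * pullVec a k (i + 1) d := by
  have h : ∀ t, nHat P a k t =
      ∑ i ∈ Finset.range t, (P ^ (t - i)).mulVec (pullVec a k (i + 1)) := by
    intro t
    induction t with
    | zero => simp [nHat]
    | succ t ih =>
      rw [nHat, ih, Finset.sum_range_succ, Matrix.mulVec_add, Matrix.mulVec_sum]
      congr 1
      · refine Finset.sum_congr rfl fun i hi => ?_
        rw [Matrix.mulVec_mulVec, ← pow_succ',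
          Nat.sub_add_comm (Finset.mem_range.1 hi).le]
      · simp
  rw [h, Finset.sum_apply]
  rfl

/-- By linearity, subtracting m n̂ centres every reward at m before mixing; with m the mean of the
arm, only noise remains. -/
theorem sHat_sub_eq_sum (a : ℕ → V → Fin K) (x : ℕ → V → ℝ) (k : Fin K) (m : ℝ) (t : ℕ) (v : V) :
    sHat P a x k t v - m * nHat P a k t v =
      ∑ i ∈ Finset.range t, ∑ d, (P ^ (t - i)) v d *
        (pullVec a k (i + 1) d * (x (i + 1) d - m)) := by
  have h : ∀ t, sHat P a x k t - m • nHat P a k t =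
      ∑ i ∈ Finset.range t, (P ^ (t - i)).mulVec
        (fun d => pullVec a k (i + 1) d * (x (i + 1) d - m)) := by
    intro t
    induction t with
    | zero => simp [nHat, sHat]
    | succ t ih =>
      have e : sHat P a x k (t + 1) - m • nHat P a k (t + 1) =
          P.mulVec (sHat P a x k t - m • nHat P a k t) +
            P.mulVec (fun d => pullVec a k (t + 1) d * (x (t + 1) d - m)) := by
        rw [sHat, nHat, ← Matrix.mulVec_smul, ← Matrix.mulVec_sub, ← Matrix.mulVec_add]
        congr 1
        funext d
        simp only [Pi.add_apply, Pi.sub_apply, Pi.mul_apply, Pi.smul_apply, smul_eq_mul]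
        ring
      rw [e, ih, Finset.sum_range_succ, Matrix.mulVec_sum]
      congr 1
      · refine Finset.sum_congr rfl fun i hi => ?_
        rw [Matrix.mulVec_mulVec, ← pow_succ',
          Nat.sub_add_comm (Finset.mem_range.1 hi).le]
      · simp
  have := congrFun (h t) v
  rw [Finset.sum_apply] at this
  exact this

theorem mulVec_mono_of_rowStochastic (hP : P ∈ Matrix.rowStochastic ℝ V) {x y : V → ℝ}
    (h : ∀ d, x d ≤ y d) (v : V) : P.mulVec x v ≤ P.mulVec y v :=
  Finset.sum_le_sum fun d _ =>
    mul_le_mul_of_nonneg_left (h d) (Matrix.nonneg_of_mem_rowStochastic hP)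

theorem mulVec_const_of_rowStochastic (hP : P ∈ Matrix.rowStochastic ℝ V) (c : ℝ) (v : V) :
    P.mulVec (fun _ => c) v = c := by
  simp only [Matrix.mulVec, dotProduct, ← Finset.sum_mul]
  rw [Matrix.sum_row_of_mem_rowStochastic hP, one_mul]

theorem nHat_nonneg (hP : P ∈ Matrix.rowStochastic ℝ V) (a : ℕ → V → Fin K) (k : Fin K) (t : ℕ)
    (v : V) : 0 ≤ nHat P a k t v := by
  induction t generalizing v with
  | zero => simp [nHat]
  | succ t ih =>
    rw [nHat]
    refine Eq.trans_le (mulVec_const_of_rowStochastic hP 0 v).symm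
      (mulVec_mono_of_rowStochastic hP (fun d => ?_) v)
    exact add_nonneg (ih d) (pullVec_nonneg a k (t + 1) d)

/-- Used twice: no late pull occurs before round η, and the bonus of the best arm has a lower bound
that does not involve its count. -/
theorem nHat_le (hP : P ∈ Matrix.rowStochastic ℝ V) (a : ℕ → V → Fin K) (k : Fin K) (t : ℕ)
    (v : V) : nHat P a k t v ≤ t := by
  induction t generalizing v with
  | zero => simp [nHat]
  | succ t ih =>
    rw [nHat]
    refine (mulVec_mono_of_rowStochastic hP (y := fun _ => ((t + 1 : ℕ) : ℝ)) (fun d => ?_) v).trans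
      (mulVec_const_of_rowStochastic hP _ v).le
    rw [Nat.cast_add, Nat.cast_one]
    exact add_le_add (ih d) (pullVec_le_one a k (t + 1) d)

/-- A round in which all agents pull arm k lifts every entry to at least 1, and averaging with
nonnegative weights keeps it there. -/
theorem one_le_nHat (hP : P ∈ Matrix.rowStochastic ℝ V) {a : ℕ → V → Fin K} {k : Fin K} {j t : ℕ}
    (hj : ∀ d, a (j + 1) d = k) (ht : j < t) (v : V) : 1 ≤ nHat P a k t v := by
  induction t, ht using Nat.le_induction generalizing v with
  | base =>
    rw [nHat]
    refine Eq.trans_le (mulVec_const_of_rowStochastic hP 1 v).symm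
      (mulVec_mono_of_rowStochastic hP (fun d => ?_) v)
    have := nHat_nonneg hP a k j d
    simp only [Pi.add_apply, pullVec, hj d, if_true]
    linarith
  | succ t _ ih =>
    rw [nHat]
    refine Eq.trans_le (mulVec_const_of_rowStochastic hP 1 v).symm
      (mulVec_mono_of_rowStochastic hP (fun d => ?_) v)
    have := pullVec_nonneg a k (t + 1) d
    have := ih d
    simp only [Pi.add_apply]
    linarith

theorem nHat_eq_zero {a : ℕ → V → Fin K} {k : Fin K} {t : ℕ}
    (h : ∀ i < t, ∀ d, a (i + 1) d ≠ k) (v : V) : nHat P a k t v = 0 := by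
  rw [nHat_eq_sum]
  refine Finset.sum_eq_zero fun i hi => Finset.sum_eq_zero fun d _ => ?_
  rw [pullVec, if_neg (h i (Finset.mem_range.1 hi) d), mul_zero]

end Trajectory

/-! ### Consensus counts and squared weights -/

section Deviation

variable {V : Type*} [Fintype V] [DecidableEq V] {K : ℕ} {G : SimpleGraph V} [DecidableRel G.Adj]
  {κ : ℝ} {lam : Fin (Fintype.card V) → ℝ}
  {u : OrthonormalBasis (Fin (Fintype.card V)) ℝ (EuclideanSpace ℝ V)}

theorem sum_split_tail {M : ℕ} (hM : 0 < M) (f : Fin M → ℝ) :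
    ∑ p, f p = f ⟨0, hM⟩ + ∑ p ∈ tailIndices M, f p := by
  have h : (Finset.univ : Finset (Fin M)) = insert ⟨0, hM⟩ (tailIndices M) := by
    ext p
    simp only [Finset.mem_univ, Finset.mem_insert, mem_tailIndices, true_iff, Fin.ext_iff]
    exact em _
  rw [h, Finset.sum_insert]
  simp [mem_tailIndices]

theorem pow_apply_eq_tail (hG : G.Connected) (hκ : 0 < κ)
    (hP : consensusMatrix G κ ∈ Matrix.rowStochastic ℝ V)
    (hu : IsOrderedEigenbasis (consensusMatrix G κ) lam u) (s : ℕ) (v d : V) :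
    (consensusMatrix G κ ^ s) v d = 1 / Fintype.card V +
      ∑ p ∈ tailIndices (Fintype.card V), lam p ^ s * (u p v * u p d) := by
  have hM : 0 < Fintype.card V := Fintype.card_pos_iff.2 ⟨v⟩
  rw [pow_apply_eq_sum hu, sum_split_tail hM]
  have h1 := eigenvalue_zero_eq_one hP hu (p := ⟨0, hM⟩) rfl
  rw [basis_mul_of_eigenvalue_eq_one hG hκ hu h1, h1, one_pow, one_mul]

theorem epsGraph_nonneg (hG : G.Connected) (hκ : 0 < κ)
    (hP : consensusMatrix G κ ∈ Matrix.rowStochastic ℝ V)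
    (hu : IsOrderedEigenbasis (consensusMatrix G κ) lam u) : 0 ≤ epsGraph (V := V) lam :=
  mul_nonneg (Real.sqrt_nonneg _) (Finset.sum_nonneg fun p hp => div_nonneg (abs_nonneg _)
    (by linarith [abs_eigenvalue_lt_one hG hκ hP hu (mem_tailIndices.1 hp)]))

theorem abs_mul_eigenvalue_lt_one (hG : G.Connected) (hκ : 0 < κ)
    (hP : consensusMatrix G κ ∈ Matrix.rowStochastic ℝ V)
    (hu : IsOrderedEigenbasis (consensusMatrix G κ) lam u) (p : Fin (Fintype.card V))
    {j : Fin (Fintype.card V)} (hj : j ∈ tailIndices (Fintype.card V)) : |lam p * lam j| < 1 := by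
  rw [abs_mul]
  have h1 := abs_eigenvalue_le_one hP hu p
  have h2 := abs_eigenvalue_lt_one hG hκ hP hu (mem_tailIndices.1 hj)
  nlinarith [abs_nonneg (lam p), abs_nonneg (lam j)]

theorem agentEps_nonneg (hG : G.Connected) (hκ : 0 < κ)
    (hP : consensusMatrix G κ ∈ Matrix.rowStochastic ℝ V)
    (hu : IsOrderedEigenbasis (consensusMatrix G κ) lam u) (v : V) : 0 ≤ agentEps lam u v :=
  mul_nonneg (Nat.cast_nonneg _) (Finset.sum_nonneg fun p _ => Finset.sum_nonneg fun j hj =>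
    mul_nonneg (div_nonneg (abs_nonneg _)
      (by linarith [abs_mul_eigenvalue_lt_one hG hκ hP hu p hj])) (aCoeff_nonneg lam u p j v))

theorem hGraph_nonneg (hG : G.Connected) (hκ : 0 < κ)
    (hP : consensusMatrix G κ ∈ Matrix.rowStochastic ℝ V)
    (hu : IsOrderedEigenbasis (consensusMatrix G κ) lam u) : 0 ≤ hGraph lam u :=
  Finset.sum_nonneg fun p _ => Finset.sum_nonneg fun j hj =>
    mul_nonneg (div_nonneg (abs_nonneg _)
      (by linarith [abs_mul_eigenvalue_lt_one hG hκ hP hu p hj]))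
      (Finset.sum_nonneg fun v _ => aCoeff_nonneg lam u p j v)

/-- The consensus count of every agent is within `ε` of the average number of pulls. -/
theorem abs_nHat_sub_le (hG : G.Connected) (hκ : 0 < κ)
    (hP : consensusMatrix G κ ∈ Matrix.rowStochastic ℝ V)
    (hu : IsOrderedEigenbasis (consensusMatrix G κ) lam u) (a : ℕ → V → Fin K) (k : Fin K)
    (t : ℕ) (v : V) :
    |nHat (consensusMatrix G κ) a k t v - totalPulls a k t / Fintype.card V| ≤
      epsGraph (V := V) lam := by
  -- Cauchy–Schwarz for a unit vector and a 0/1 vector of length at most √M: the source of the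
  -- factor √M in ε.
  have hinner : ∀ p i, |∑ d, u p d * pullVec a k (i + 1) d| ≤ Real.sqrt (Fintype.card V) := by
    intro p i
    refine Real.abs_le_sqrt ?_
    refine (Finset.sum_mul_sq_le_sq_mul_sq _ _ _).trans ?_
    have h1 : ∑ d, u p d ^ 2 = 1 := by
      simpa [sq] using sum_mul_basis u p p
    rw [h1, one_mul]
    calc ∑ d, pullVec a k (i + 1) d ^ 2 ≤ ∑ _d : V, (1 : ℝ) :=
          Finset.sum_le_sum fun d _ => by rw [pullVec_sq]; exact pullVec_le_one _ _ _ _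
      _ = Fintype.card V := by simp
  have h : nHat (consensusMatrix G κ) a k t v - totalPulls a k t / Fintype.card V =
      ∑ p ∈ tailIndices (Fintype.card V), ∑ i ∈ Finset.range t,
        lam p ^ (t - i) * (u p v * ∑ d, u p d * pullVec a k (i + 1) d) := by
    rw [nHat_eq_sum, totalPulls, Finset.sum_div, ← Finset.sum_sub_distrib, Finset.sum_comm]
    refine Finset.sum_congr rfl fun i _ => ?_
    simp only [pow_apply_eq_tail hG hκ hP hu, add_mul, Finset.sum_add_distrib]
    rw [← Finset.mul_sum, Finset.mul_sum]
    simp only [Finset.sum_mul, Finset.mul_sum]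
    rw [Finset.sum_comm (s := Finset.univ) (t := tailIndices (Fintype.card V))]
    have : ∀ x y z : ℝ, x = z → x + y - z = y := fun x y z h => by rw [h]; ring
    rw [this _ _ _ ?_]
    · refine Finset.sum_congr rfl fun p _ => Finset.sum_congr rfl fun d _ => by ring
    · rw [Finset.sum_div]
      exact Finset.sum_congr rfl fun d _ => by ring
  rw [h, epsGraph, Finset.mul_sum]
  refine (Finset.abs_sum_le_sum_abs _ _).trans (Finset.sum_le_sum fun p hp => ?_)
  refine (Finset.abs_sum_le_sum_abs _ _).trans ?_
  have hl := abs_eigenvalue_lt_one hG hκ hP hu (mem_tailIndices.1 hp)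
  calc ∑ i ∈ Finset.range t, |lam p ^ (t - i) * (u p v * ∑ d, u p d * pullVec a k (i + 1) d)|
      ≤ ∑ i ∈ Finset.range t, |lam p| ^ (t - i) * Real.sqrt (Fintype.card V) := by
        refine Finset.sum_le_sum fun i _ => ?_
        rw [abs_mul, abs_mul, abs_pow]
        refine mul_le_mul_of_nonneg_left ?_ (pow_nonneg (abs_nonneg _) _)
        calc |u p v| * |∑ d, u p d * pullVec a k (i + 1) d| ≤ 1 * Real.sqrt (Fintype.card V) :=
              mul_le_mul (abs_basis_le_one u p v) (hinner p i) (abs_nonneg _) zero_le_one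
          _ = Real.sqrt (Fintype.card V) := one_mul _
    _ = Real.sqrt (Fintype.card V) * ∑ i ∈ Finset.range t, |lam p| ^ (t - i) := by
        rw [← Finset.sum_mul, mul_comm]
    _ ≤ Real.sqrt (Fintype.card V) * (|lam p| / (1 - |lam p|)) :=
        mul_le_mul_of_nonneg_left (sum_range_pow_sub_le (abs_nonneg _) hl t) (Real.sqrt_nonneg _)

/-- The predictable quadratic variation of the consensus estimate is at most
`(n̂ + ε^v) / M`. -/
theorem sum_sq_weights_le (hG : G.Connected) (hκ : 0 < κ)
    (hP : consensusMatrix G κ ∈ Matrix.rowStochastic ℝ V)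
    (hu : IsOrderedEigenbasis (consensusMatrix G κ) lam u) (a : ℕ → V → Fin K) (k : Fin K)
    (t : ℕ) (v : V) :
    ∑ i ∈ Finset.range t, ∑ d,
        ((consensusMatrix G κ ^ (t - i)) v d * pullVec a k (i + 1) d) ^ 2 ≤
      (nHat (consensusMatrix G κ) a k t v + agentEps lam u v) / Fintype.card V := by
  set P := consensusMatrix G κ
  have hM : (0 : ℝ) < Fintype.card V := by exact_mod_cast Fintype.card_pos_iff.2 ⟨v⟩
  have hexp : ∀ i, ∑ d, ((P ^ (t - i)) v d * pullVec a k (i + 1) d) ^ 2 =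
      (∑ d, (P ^ (t - i)) v d * pullVec a k (i + 1) d) / Fintype.card V +
      ∑ p, ∑ j ∈ tailIndices (Fintype.card V), (lam p * lam j) ^ (t - i) *
        ((u p v * u j v) * ∑ d, u p d * u j d * pullVec a k (i + 1) d) := by
    intro i
    have h1 : ∀ d, ((P ^ (t - i)) v d * pullVec a k (i + 1) d) ^ 2 =
        (P ^ (t - i)) v d * pullVec a k (i + 1) d / Fintype.card V +
        ∑ p, ∑ j ∈ tailIndices (Fintype.card V), (lam p * lam j) ^ (t - i) *
          ((u p v * u j v) * (u p d * u j d * pullVec a k (i + 1) d)) := by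
      intro d
      -- Only one factor of the square is split into 1/M and a tail; the other is kept whole or
      -- expanded over all p. The 1/M part reproduces n̂/M, and the rest is why p runs from 1 but j
      -- from 2 in ε^v.
      have h2 : (P ^ (t - i)) v d ^ 2 = (P ^ (t - i)) v d * (1 / Fintype.card V) +
          ∑ p, ∑ j ∈ tailIndices (Fintype.card V),
            (lam p ^ (t - i) * (u p v * u p d)) * (lam j ^ (t - i) * (u j v * u j d)) := by
        rw [← Finset.sum_mul_sum, ← pow_apply_eq_sum hu, ← mul_add,
          ← pow_apply_eq_tail hG hκ hP hu, sq]
      rw [mul_pow, pullVec_sq, h2, add_mul, Finset.sum_mul]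
      congr 1
      · ring
      · refine Finset.sum_congr rfl fun p _ => ?_
        rw [Finset.sum_mul]
        exact Finset.sum_congr rfl fun j _ => by rw [mul_pow]; ring
    simp only [h1, Finset.sum_add_distrib, Finset.sum_div]
    congr 1
    rw [Finset.sum_comm]
    refine Finset.sum_congr rfl fun p _ => ?_
    rw [Finset.sum_comm]
    refine Finset.sum_congr rfl fun j _ => ?_
    rw [← Finset.mul_sum, ← Finset.mul_sum]
  simp only [hexp, Finset.sum_add_distrib]
  rw [← Finset.sum_div, ← nHat_eq_sum, add_div]
  refine add_le_add le_rfl ?_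
  rw [agentEps, mul_div_assoc, mul_div_cancel₀ _ hM.ne', Finset.sum_comm]
  refine Finset.sum_le_sum fun p _ => ?_
  rw [Finset.sum_comm]
  refine Finset.sum_le_sum fun j hj => ?_
  calc ∑ i ∈ Finset.range t, (lam p * lam j) ^ (t - i) *
          ((u p v * u j v) * ∑ d, u p d * u j d * pullVec a k (i + 1) d)
      ≤ ∑ i ∈ Finset.range t, |lam p * lam j| ^ (t - i) * aCoeff lam u p j v :=
        Finset.sum_le_sum fun i _ => pow_mul_sum_le_aCoeff lam u p j v _ (pullVec_eq a k (i + 1))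
    _ = (∑ i ∈ Finset.range t, |lam p * lam j| ^ (t - i)) * aCoeff lam u p j v := by
        rw [Finset.sum_mul]
    _ ≤ |lam p * lam j| / (1 - |lam p * lam j|) * aCoeff lam u p j v :=
        mul_le_mul_of_nonneg_right (sum_range_pow_sub_le (abs_nonneg _)
          (abs_mul_eigenvalue_lt_one hG hκ hP hu p hj) t) (aCoeff_nonneg lam u p j v)

end Deviation

/-! ### Self-normalized second moments -/

section Noise

variable {Ω : Type*} {mΩ : MeasurableSpace Ω}

theorem integrable_mul_of_indep {μ : Measure Ω} [IsProbabilityMeasure μ]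
    {m₁ m₂ : MeasurableSpace Ω} (h : Indep m₁ m₂ μ)
    {f g : Ω → ℝ} (hf : Measurable[m₁] f) (hg : Measurable[m₂] g) (hfi : Integrable f μ)
    (hgi : Integrable g μ) :
    Integrable (fun ω => f ω * g ω) μ ∧ ∫ ω, f ω * g ω ∂μ = (∫ ω, f ω ∂μ) * ∫ ω, g ω ∂μ := by
  have hfg : IndepFun f g μ := by
    rw [IndepFun_iff_Indep]
    exact indep_of_indep_of_le_left (indep_of_indep_of_le_right h hg.comap_le) hf.comap_le
  exact ⟨hfg.integrable_mul hfi hgi, hfg.integral_mul_eq_mul_integral hfi.1 hgi.1⟩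

/-- Centred noise with variances at most `ρ`: the noise terms of one round are uncorrelated with
each other and independent of the past. -/
structure IsRoundNoise {D : Type*} (μ : Measure Ω) (ℱ : Filtration ℕ mΩ) (ξ : ℕ → D → Ω → ℝ)
    (ρ : ℝ) : Prop where
  measurable_succ : ∀ i d, Measurable[ℱ (i + 1)] (ξ i d)
  memLp : ∀ i d, MemLp (ξ i d) 2 μ
  integral_eq_zero : ∀ i d, ∫ ω, ξ i d ω ∂μ = 0
  integral_sq_le : ∀ i d, ∫ ω, ξ i d ω ^ 2 ∂μ ≤ ρ
  integral_mul : ∀ i d d', d ≠ d' → ∫ ω, ξ i d ω * ξ i d' ω ∂μ = 0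
  indep : ∀ i, Indep (⨆ d, MeasurableSpace.comap (ξ i d) inferInstance) (ℱ i) μ

variable {D : Type*} {μ : Measure Ω} {ℱ : Filtration ℕ mΩ}
  {ξ Z : ℕ → D → Ω → ℝ} {ρ : ℝ}

theorem IsRoundNoise.integral_past_mul [IsProbabilityMeasure μ] (h : IsRoundNoise μ ℱ ξ ρ) {i : ℕ} {H g : Ω → ℝ}
    (hH : Measurable[ℱ i] H) (hHi : Integrable H μ)
    (hg : Measurable[⨆ d, MeasurableSpace.comap (ξ i d) inferInstance] g) (hgi : Integrable g μ) :
    Integrable (fun ω => H ω * g ω) μ ∧ ∫ ω, H ω * g ω ∂μ = (∫ ω, H ω ∂μ) * ∫ ω, g ω ∂μ := by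
  exact integrable_mul_of_indep (h.indep i).symm hH hg hHi hgi

theorem IsRoundNoise.measurable_comap (ξ : ℕ → D → Ω → ℝ) (i : ℕ) (d : D) :
    Measurable[⨆ d, MeasurableSpace.comap (ξ i d) inferInstance] (ξ i d) :=
  (comap_measurable (ξ i d)).mono (le_iSup (fun d => MeasurableSpace.comap (ξ i d) inferInstance) d)
    le_rfl

variable [Fintype D]

/-- The noise accumulated with the weights `Z` during the first `n` rounds. -/
def weightedNoise (Z ξ : ℕ → D → Ω → ℝ) (n : ℕ) (ω : Ω) : ℝ :=
  ∑ i ∈ Finset.range n, ∑ d, Z i d ω * ξ i d ω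

/-- The sum of the squared weights of the first `n` rounds. -/
def sqWeights (Z : ℕ → D → Ω → ℝ) (n : ℕ) (ω : Ω) : ℝ :=
  ∑ i ∈ Finset.range n, ∑ d, Z i d ω ^ 2

theorem memLp_two_weight_mul {Y H : Ω → ℝ} (hY : MemLp Y 2 μ) (hH : Measurable H) {B : ℝ}
    (hb : ∀ ω, |H ω| ≤ B) : MemLp (fun ω => H ω * Y ω) 2 μ := by
  refine MemLp.of_le_mul (c := B) hY (hH.aestronglyMeasurable.mul hY.1) ?_
  filter_upwards with ω
  rw [norm_mul]
  exact mul_le_mul_of_nonneg_right (hb ω) (norm_nonneg _)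

theorem sqWeights_nonneg (Z : ℕ → D → Ω → ℝ) (n : ℕ) (ω : Ω) : 0 ≤ sqWeights Z n ω :=
  Finset.sum_nonneg fun _ _ => Finset.sum_nonneg fun _ _ => sq_nonneg _

theorem sqWeights_succ (Z : ℕ → D → Ω → ℝ) (n : ℕ) (ω : Ω) :
    sqWeights Z (n + 1) ω = sqWeights Z n ω + ∑ d, Z n d ω ^ 2 := Finset.sum_range_succ _ _

theorem weightedNoise_succ (Z ξ : ℕ → D → Ω → ℝ) (n : ℕ) (ω : Ω) :
    weightedNoise Z ξ (n + 1) ω = weightedNoise Z ξ n ω + ∑ d, Z n d ω * ξ n d ω :=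
  Finset.sum_range_succ _ _

/-- The shift is the point: the squared weights up to and including index n are known before the
noise of index n arrives. -/
theorem measurable_sqWeights (hZ : ∀ i d, Measurable[ℱ i] (Z i d)) (n : ℕ) :
    Measurable[ℱ n] (sqWeights Z (n + 1)) := by
  refine Finset.measurable_sum _ fun i hi => Finset.measurable_sum _ fun d _ => ?_
  exact ((hZ i d).mono (ℱ.mono (Nat.lt_succ_iff.1 (Finset.mem_range.1 hi))) le_rfl).pow_const 2

theorem IsRoundNoise.measurable_weightedNoise (h : IsRoundNoise μ ℱ ξ ρ)
    (hZ : ∀ i d, Measurable[ℱ i] (Z i d)) (n : ℕ) : Measurable[ℱ n] (weightedNoise Z ξ n) := by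
  refine Finset.measurable_sum _ fun i hi => Finset.measurable_sum _ fun d _ => ?_
  have hi := Finset.mem_range.1 hi
  exact ((hZ i d).mono (ℱ.mono hi.le) le_rfl).mul
    ((h.measurable_succ i d).mono (ℱ.mono hi) le_rfl)

theorem IsRoundNoise.memLp_weightedNoise (h : IsRoundNoise μ ℱ ξ ρ)
    (hZ : ∀ i d, Measurable[ℱ i] (Z i d)) (hb : ∀ i d ω, |Z i d ω| ≤ 1) (n : ℕ) :
    MemLp (weightedNoise Z ξ n) 2 μ := by
  have := memLp_finsetSum (Finset.range n) fun i _ => memLp_finsetSum Finset.univ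
    fun d _ => memLp_two_weight_mul (h.memLp i d) ((hZ i d).mono (ℱ.le i) le_rfl) (hb i d)
  exact this

variable [IsProbabilityMeasure μ]

theorem integrable_of_bounded {H : Ω → ℝ} (hH : Measurable H) {B : ℝ} (hb : ∀ ω, |H ω| ≤ B) :
    Integrable H μ :=
  Integrable.of_bound hH.aestronglyMeasurable B (Filter.Eventually.of_forall hb)

/-- One round: the noise of the round, squared and weighted by a bounded predictable `w`. -/
theorem IsRoundNoise.integral_sq_round_le (h : IsRoundNoise μ ℱ ξ ρ)
    (hZ : ∀ i d, Measurable[ℱ i] (Z i d)) (hb : ∀ i d ω, |Z i d ω| ≤ 1) (n : ℕ) {w : Ω → ℝ}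
    (hw : Measurable[ℱ n] w) (hw0 : ∀ ω, 0 ≤ w ω) {B : ℝ} (hwB : ∀ ω, w ω ≤ B) :
    Integrable (fun ω => (∑ d, Z n d ω * ξ n d ω) ^ 2 * w ω) μ ∧
    ∫ ω, (∑ d, Z n d ω * ξ n d ω) ^ 2 * w ω ∂μ ≤ ρ * ∫ ω, (∑ d, Z n d ω ^ 2) * w ω ∂μ := by
  have hB : ∀ d d' ω, |Z n d ω * Z n d' ω * w ω| ≤ B := fun d d' ω => by
    rw [abs_mul, abs_mul, abs_of_nonneg (hw0 ω)]
    have := mul_le_one₀ (hb n d ω) (abs_nonneg _) (hb n d' ω)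
    nlinarith [hw0 ω, hwB ω]
  have hm : ∀ d d', Measurable[ℱ n] fun ω => Z n d ω * Z n d' ω * w ω := fun d d' =>
    ((hZ n d).mul (hZ n d')).mul hw
  have hi : ∀ d d', Integrable (fun ω => Z n d ω * Z n d' ω * w ω) μ := fun d d' =>
    integrable_of_bounded ((hm d d').mono (ℱ.le n) le_rfl) (hB d d')
  have key : ∀ d d', Integrable (fun ω => Z n d ω * Z n d' ω * w ω * (ξ n d ω * ξ n d' ω)) μ ∧
      ∫ ω, Z n d ω * Z n d' ω * w ω * (ξ n d ω * ξ n d' ω) ∂μ =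
        (∫ ω, Z n d ω * Z n d' ω * w ω ∂μ) * ∫ ω, ξ n d ω * ξ n d' ω ∂μ :=
      fun d d' => h.integral_past_mul (hm d d') (hi d d')
    ((IsRoundNoise.measurable_comap ξ n d).mul (IsRoundNoise.measurable_comap ξ n d'))
    ((h.memLp n d).integrable_mul (h.memLp n d'))
  have hexp : ∀ ω, (∑ d, Z n d ω * ξ n d ω) ^ 2 * w ω =
      ∑ d, ∑ d', Z n d ω * Z n d' ω * w ω * (ξ n d ω * ξ n d' ω) := fun ω => by
    rw [sq, Finset.sum_mul_sum, Finset.sum_mul]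
    refine Finset.sum_congr rfl fun d _ => ?_
    rw [Finset.sum_mul]
    exact Finset.sum_congr rfl fun d' _ => by ring
  simp only [hexp]
  have hint : ∀ d, Integrable (fun ω => ∑ d', Z n d ω * Z n d' ω * w ω * (ξ n d ω * ξ n d' ω)) μ :=
    fun d => integrable_finsetSum _ fun d' _ => (key d d').1
  refine ⟨integrable_finsetSum _ fun d _ => hint d, ?_⟩
  rw [integral_finsetSum _ fun d _ => hint d]
  simp only [Finset.sum_mul]
  have hi2 : ∀ d, Integrable (fun ω => Z n d ω ^ 2 * w ω) μ := fun d => by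
    simpa only [sq] using hi d d
  rw [integral_finsetSum _ fun d _ => hi2 d, Finset.mul_sum]
  refine Finset.sum_le_sum fun d _ => ?_
  rw [integral_finsetSum _ fun d' _ => (key d d').1, Finset.sum_eq_single d]
  · rw [(key d d).2, mul_comm]
    have e1 : ∫ ω, Z n d ω * Z n d ω * w ω ∂μ = ∫ ω, Z n d ω ^ 2 * w ω ∂μ := by simp only [sq]
    have e2 : ∫ ω, ξ n d ω * ξ n d ω ∂μ = ∫ ω, ξ n d ω ^ 2 ∂μ := by simp only [sq]
    rw [e1, e2]
    exact mul_le_mul_of_nonneg_right (h.integral_sq_le n d)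
      (integral_nonneg fun ω => mul_nonneg (sq_nonneg _) (hw0 ω))
  · intro d' _ hd
    rw [(key d d').2, h.integral_mul n d d' hd.symm, mul_zero]
  · simp

/-- Self-normalized second moment bound. -/
theorem IsRoundNoise.integral_sq_mul_le (h : IsRoundNoise μ ℱ ξ ρ) (hρ : 0 ≤ ρ)
    (hZ : ∀ i d, Measurable[ℱ i] (Z i d)) (hb : ∀ i d ω, |Z i d ω| ≤ 1)
    {W Ψ : ℝ → ℝ} (hW : Measurable W) (hΨ : Measurable Ψ) (hW0 : ∀ x, 0 ≤ W x) {B : ℝ}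
    (hWB : ∀ x, W x ≤ B) (hWa : ∀ a b, 0 ≤ a → a ≤ b → W b ≤ W a)
    (hWΨ : ∀ a b, 0 ≤ a → a ≤ b → (b - a) * W b ≤ Ψ b - Ψ a) (hΨ0 : Ψ 0 = 0) (n : ℕ) :
    Integrable (fun ω => weightedNoise Z ξ n ω ^ 2 * W (sqWeights Z n ω)) μ ∧
    ∫ ω, weightedNoise Z ξ n ω ^ 2 * W (sqWeights Z n ω) ∂μ ≤
      ρ * ∫ ω, Ψ (sqWeights Z n ω) ∂μ := by
  have hΨm : ∀ a b, 0 ≤ a → a ≤ b → Ψ a ≤ Ψ b := fun a b h0 hab => by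
    have := mul_nonneg (sub_nonneg.2 hab) (hW0 b)
    linarith [hWΨ a b h0 hab]
  have hZm : ∀ i d, Measurable (Z i d) := fun i d => (hZ i d).mono (ℱ.le i) le_rfl
  have hVm : ∀ n, Measurable (sqWeights Z n) := fun n =>
    Finset.measurable_sum _ fun i _ => Finset.measurable_sum _ fun d _ => (hZm i d).pow_const 2
  have hVle : ∀ n ω, sqWeights Z n ω ≤ n * Fintype.card D := fun n ω => by
    refine (Finset.sum_le_card_nsmul _ _ (Fintype.card D : ℝ) fun i _ => ?_).trans
      (by rw [Finset.card_range, nsmul_eq_mul])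
    refine (Finset.sum_le_card_nsmul _ _ (1 : ℝ) fun d _ => ?_).trans
      (by rw [Finset.card_univ, nsmul_eq_mul, mul_one])
    rw [← sq_abs]
    exact pow_le_one₀ (abs_nonneg _) (hb i d ω)
  have hΨi : ∀ n, Integrable (fun ω => Ψ (sqWeights Z n ω)) μ := fun n => by
    refine integrable_of_bounded (hΨ.comp (hVm n)) (B := Ψ (n * Fintype.card D)) fun ω => ?_
    have h1 := hΨm 0 _ le_rfl (sqWeights_nonneg Z n ω)
    rw [hΨ0] at h1
    rw [abs_of_nonneg h1]
    exact hΨm _ _ (sqWeights_nonneg Z n ω) (hVle n ω)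
  have hSW : ∀ n {w : Ω → ℝ}, Measurable w → (∀ ω, 0 ≤ w ω) → (∀ ω, w ω ≤ B) →
      Integrable (fun ω => weightedNoise Z ξ n ω ^ 2 * w ω) μ := fun n w hw h0 hB => by
    refine (h.memLp_weightedNoise hZ hb n).integrable_sq.mul_bdd (c := B)
      hw.aestronglyMeasurable ?_
    filter_upwards with ω
    rw [Real.norm_eq_abs, abs_of_nonneg (h0 ω)]
    exact hB ω
  refine ⟨hSW n (hW.comp (hVm n)) (fun _ => hW0 _) fun _ => hWB _, ?_⟩
  induction n with
  | zero => simp [weightedNoise, sqWeights, hΨ0]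
  | succ n ih =>
    set w : Ω → ℝ := fun ω => W (sqWeights Z (n + 1) ω) with hwdef
    have hw : Measurable[ℱ n] w := hW.comp (measurable_sqWeights hZ n)
    have hw' : Measurable w := hw.mono (ℱ.le n) le_rfl
    obtain ⟨hYi, hY⟩ := h.integral_sq_round_le hZ hb n hw (fun _ => hW0 _) fun _ => hWB _
    have hS := h.memLp_weightedNoise hZ hb n
    -- The accumulated noise, the weight and `w` are all `ℱ n`-measurable, whereas the new noise is
    -- centred and independent of `ℱ n`.
    have hcross : ∀ d, Integrable (fun ω => weightedNoise Z ξ n ω * Z n d ω * w ω * ξ n d ω) μ ∧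
        ∫ ω, weightedNoise Z ξ n ω * Z n d ω * w ω * ξ n d ω ∂μ = 0 := fun d => by
      have hm : Measurable[ℱ n] fun ω => weightedNoise Z ξ n ω * Z n d ω * w ω :=
        ((h.measurable_weightedNoise hZ n).mul (hZ n d)).mul hw
      have hi : Integrable (fun ω => weightedNoise Z ξ n ω * Z n d ω * w ω) μ := by
        simp only [mul_assoc]
        refine (hS.integrable one_le_two).mul_bdd (c := B) ((hZm n d).mul hw').aestronglyMeasurable ?_
        filter_upwards with ω
        rw [Real.norm_eq_abs, abs_mul, abs_of_nonneg (hW0 _)]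
        have := hb n d ω
        nlinarith [hW0 (sqWeights Z (n + 1) ω), hWB (sqWeights Z (n + 1) ω)]
      have := h.integral_past_mul hm hi (IsRoundNoise.measurable_comap ξ n d)
        ((h.memLp n d).integrable one_le_two)
      rwa [h.integral_eq_zero, mul_zero] at this
    have hexp : ∀ ω, weightedNoise Z ξ (n + 1) ω ^ 2 * w ω =
        weightedNoise Z ξ n ω ^ 2 * w ω +
        2 * (∑ d, weightedNoise Z ξ n ω * Z n d ω * w ω * ξ n d ω) +
        (∑ d, Z n d ω * ξ n d ω) ^ 2 * w ω := fun ω => by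
      rw [weightedNoise_succ]
      have : ∑ d, weightedNoise Z ξ n ω * Z n d ω * w ω * ξ n d ω =
          weightedNoise Z ξ n ω * w ω * ∑ d, Z n d ω * ξ n d ω := by
        rw [Finset.mul_sum]
        exact Finset.sum_congr rfl fun d _ => by ring
      rw [this]
      ring
    have hS1 := hSW n hw' (fun _ => hW0 _) fun _ => hWB _
    have hS2 := hSW n (hW.comp (hVm n)) (fun _ => hW0 _) fun _ => hWB _
    have hC : Integrable
        (fun ω => 2 * (∑ d, weightedNoise Z ξ n ω * Z n d ω * w ω * ξ n d ω)) μ :=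
      (integrable_finsetSum _ fun d _ => (hcross d).1).const_mul 2
    have hSC : Integrable (fun ω => weightedNoise Z ξ n ω ^ 2 * w ω +
        2 * (∑ d, weightedNoise Z ξ n ω * Z n d ω * w ω * ξ n d ω)) μ := hS1.add hC
    have hC0 : ∫ ω, 2 * (∑ d, weightedNoise Z ξ n ω * Z n d ω * w ω * ξ n d ω) ∂μ = 0 := by
      rw [integral_const_mul, integral_finsetSum _ fun d _ => (hcross d).1,
        Finset.sum_eq_zero fun d _ => (hcross d).2, mul_zero]
    have hmono : ∀ ω, sqWeights Z n ω ≤ sqWeights Z (n + 1) ω := fun ω => by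
      rw [sqWeights_succ]
      linarith [Finset.sum_nonneg fun d (_ : d ∈ Finset.univ) => sq_nonneg (Z n d ω)]
    -- The weight at the new, larger V is at most the weight at the old one, so the old noise is
    -- controlled by the induction hypothesis.
    have h1 : ∫ ω, weightedNoise Z ξ n ω ^ 2 * w ω ∂μ ≤ ρ * ∫ ω, Ψ (sqWeights Z n ω) ∂μ :=
      (integral_mono hS1 hS2 fun ω => mul_le_mul_of_nonneg_left
        (hWa _ _ (sqWeights_nonneg Z n ω) (hmono ω)) (sq_nonneg _)).trans ih
    -- The new squared weights are the increment of V, so the variance of the round is paid by the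
    -- increment of Ψ, and these telescope.
    have h2 : ∫ ω, (∑ d, Z n d ω ^ 2) * w ω ∂μ ≤
        ∫ ω, (Ψ (sqWeights Z (n + 1) ω) - Ψ (sqWeights Z n ω)) ∂μ := by
      refine integral_mono_of_nonneg (Filter.Eventually.of_forall fun ω =>
        mul_nonneg (Finset.sum_nonneg fun d _ => sq_nonneg _) (hW0 _))
        ((hΨi (n + 1)).sub (hΨi n)) (Filter.Eventually.of_forall fun ω => ?_)
      have := hWΨ _ _ (sqWeights_nonneg Z n ω) (hmono ω)
      have e : sqWeights Z (n + 1) ω - sqWeights Z n ω = ∑ d, Z n d ω ^ 2 := by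
        rw [sqWeights_succ]; ring
      rwa [e] at this
    rw [integral_sub (hΨi (n + 1)) (hΨi n)] at h2
    calc ∫ ω, weightedNoise Z ξ (n + 1) ω ^ 2 * w ω ∂μ
        = ∫ ω, weightedNoise Z ξ n ω ^ 2 * w ω ∂μ + 0 +
          ∫ ω, (∑ d, Z n d ω * ξ n d ω) ^ 2 * w ω ∂μ := by
          simp only [hexp]
          rw [integral_add hSC hYi, integral_add hS1 hC, hC0]
      _ ≤ ρ * ∫ ω, Ψ (sqWeights Z n ω) ∂μ + 0 + ρ * (∫ ω, Ψ (sqWeights Z (n + 1) ω) ∂μ -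
          ∫ ω, Ψ (sqWeights Z n ω) ∂μ) :=
          add_le_add (add_le_add h1 le_rfl) (hY.trans (mul_le_mul_of_nonneg_left h2 hρ))
      _ = ρ * ∫ ω, Ψ (sqWeights Z (n + 1) ω) ∂μ := by ring

theorem IsRoundNoise.integral_sq_mul_le_of_le (h : IsRoundNoise μ ℱ ξ ρ) (hρ : 0 ≤ ρ)
    (hZ : ∀ i d, Measurable[ℱ i] (Z i d)) (hb : ∀ i d ω, |Z i d ω| ≤ 1)
    {W Ψ : ℝ → ℝ} (hW : Measurable W) (hΨ : Measurable Ψ) (hW0 : ∀ x, 0 ≤ W x) {B : ℝ}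
    (hWB : ∀ x, W x ≤ B) (hWa : ∀ a b, 0 ≤ a → a ≤ b → W b ≤ W a)
    (hWΨ : ∀ a b, 0 ≤ a → a ≤ b → (b - a) * W b ≤ Ψ b - Ψ a) (hΨ0 : Ψ 0 = 0) {n : ℕ} {c : ℝ}
    (hc : ∀ ω, sqWeights Z n ω ≤ c) :
    Integrable (fun ω => weightedNoise Z ξ n ω ^ 2 * W (sqWeights Z n ω)) μ ∧
    ∫ ω, weightedNoise Z ξ n ω ^ 2 * W (sqWeights Z n ω) ∂μ ≤ ρ * Ψ c := by
  obtain ⟨h1, h2⟩ := h.integral_sq_mul_le hρ hZ hb hW hΨ hW0 hWB hWa hWΨ hΨ0 n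
  refine ⟨h1, h2.trans (mul_le_mul_of_nonneg_left ?_ hρ)⟩
  have hΨm : ∀ a b, 0 ≤ a → a ≤ b → Ψ a ≤ Ψ b := fun a b h0 hab => by
    have := mul_nonneg (sub_nonneg.2 hab) (hW0 b)
    linarith [hWΨ a b h0 hab]
  have h3 : ∫ ω, Ψ (sqWeights Z n ω) ∂μ ≤ ∫ _, Ψ c ∂μ := by
    refine integral_mono_of_nonneg (Filter.Eventually.of_forall fun ω => ?_)
      (integrable_const _) (Filter.Eventually.of_forall fun ω =>
        hΨm _ _ (sqWeights_nonneg Z n ω) (hc ω))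
    have := hΨm 0 _ le_rfl (sqWeights_nonneg Z n ω)
    rwa [hΨ0] at this
  simpa using h3

/-- Logarithmic potential. -/
theorem IsRoundNoise.integral_sq_div_max_le (h : IsRoundNoise μ ℱ ξ ρ) (hρ : 0 ≤ ρ)
    (hZ : ∀ i d, Measurable[ℱ i] (Z i d)) (hb : ∀ i d ω, |Z i d ω| ≤ 1) {c₀ c : ℝ} (hc₀ : 0 < c₀)
    (hc : c₀ ≤ c) {n : ℕ} (hn : ∀ ω, sqWeights Z n ω ≤ c) :
    Integrable (fun ω => weightedNoise Z ξ n ω ^ 2 * (max (sqWeights Z n ω) c₀)⁻¹) μ ∧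
    ∫ ω, weightedNoise Z ξ n ω ^ 2 * (max (sqWeights Z n ω) c₀)⁻¹ ∂μ ≤
      ρ * (1 + Real.log (c / c₀)) := by
  have hpos : ∀ x, 0 < max x c₀ := fun x => lt_max_of_lt_right hc₀
  -- Ψ is the antiderivative of W: slope 1/c₀ up to c₀, slope 1/x beyond it. As W decreases, its
  -- value at the right end underestimates the integral.
  obtain ⟨h1, h2⟩ := h.integral_sq_mul_le_of_le hρ hZ hb (W := fun x => (max x c₀)⁻¹)
    (Ψ := fun x => min x c₀ / c₀ + Real.log (max x c₀ / c₀)) (B := c₀⁻¹) (by fun_prop)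
    (by fun_prop) (fun x => (inv_pos.2 (hpos x)).le)
    (fun x => inv_anti₀ hc₀ (le_max_right _ _))
    (fun a b _ hab => inv_anti₀ (hpos a) (max_le_max_right _ hab)) (fun a b ha hab => by
      have hlog : ∀ x y, c₀ ≤ x → x ≤ y →
          (y - x) * y⁻¹ ≤ Real.log (y / c₀) - Real.log (x / c₀) := fun x y hx hxy => by
        have hx0 : 0 < x := by linarith
        have hy0 : 0 < y := by linarith
        rw [Real.log_div hy0.ne' hc₀.ne', Real.log_div hx0.ne' hc₀.ne']
        have := Real.log_le_sub_one_of_pos (div_pos hx0 hy0)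
        rw [Real.log_div hx0.ne' hy0.ne'] at this
        have e : (y - x) * y⁻¹ = 1 - x / y := by field_simp
        linarith
      rcases le_total b c₀ with hb' | hb'
      · rw [max_eq_right hb', max_eq_right (hab.trans hb'), min_eq_left hb',
          min_eq_left (hab.trans hb')]
        apply le_of_eq; field_simp; ring
      · rcases le_total a c₀ with ha' | ha'
        · rw [max_eq_left hb', max_eq_right ha', min_eq_right hb', min_eq_left ha']
          have h1 := hlog c₀ b le_rfl hb'
          have h2 : (c₀ - a) * b⁻¹ ≤ (c₀ - a) * c₀⁻¹ :=
            mul_le_mul_of_nonneg_left (inv_anti₀ hc₀ hb') (by linarith)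
          have e1 : (b - a) * b⁻¹ = (b - c₀) * b⁻¹ + (c₀ - a) * b⁻¹ := by ring
          have e2 : (c₀ - a) * c₀⁻¹ = c₀ / c₀ - a / c₀ := by ring
          linarith
        · rw [max_eq_left hb', max_eq_left ha', min_eq_right hb', min_eq_right ha']
          linarith [hlog a b ha' hab])
    (by simp [hc₀.le, hc₀.ne']) hn
  refine ⟨h1, h2.trans (le_of_eq ?_)⟩
  rw [min_eq_right hc, max_eq_left hc, div_self hc₀.ne']

/-- Bounded potential. -/
theorem IsRoundNoise.integral_sq_div_max_sq_le (h : IsRoundNoise μ ℱ ξ ρ) (hρ : 0 ≤ ρ)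
    (hZ : ∀ i d, Measurable[ℱ i] (Z i d)) (hb : ∀ i d ω, |Z i d ω| ≤ 1) {c₀ c : ℝ} (hc₀ : 0 < c₀)
    (hc : c₀ ≤ c) {n : ℕ} (hn : ∀ ω, sqWeights Z n ω ≤ c) :
    Integrable (fun ω => weightedNoise Z ξ n ω ^ 2 * (c₀ / max (sqWeights Z n ω) c₀ ^ 2)) μ ∧
    ∫ ω, weightedNoise Z ξ n ω ^ 2 * (c₀ / max (sqWeights Z n ω) c₀ ^ 2) ∂μ ≤
      ρ * (2 - c₀ / c) := by
  have hpos : ∀ x, 0 < max x c₀ := fun x => lt_max_of_lt_right hc₀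
  -- Again Ψ integrates W: it gains 1 up to c₀ and 1 - c₀/c from c₀ to c.
  obtain ⟨h1, h2⟩ := h.integral_sq_mul_le_of_le hρ hZ hb (W := fun x => c₀ / max x c₀ ^ 2)
    (Ψ := fun x => min x c₀ / c₀ + (1 - c₀ / max x c₀)) (B := c₀ / c₀ ^ 2) (by fun_prop)
    (by fun_prop) (fun x => by have := hpos x; positivity)
    (fun x => div_le_div_of_nonneg_left hc₀.le (by positivity)
      (pow_le_pow_left₀ hc₀.le (le_max_right _ _) 2))
    (fun a b _ hab => div_le_div_of_nonneg_left hc₀.le (pow_pos (hpos a) 2)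
      (pow_le_pow_left₀ (hpos a).le (max_le_max_right _ hab) 2)) (fun a b ha hab => by
      have hlog : ∀ x y, c₀ ≤ x → x ≤ y →
          (y - x) * (c₀ / y ^ 2) ≤ c₀ / x - c₀ / y := fun x y hx hxy => by
        have hx0 : 0 < x := by linarith
        have hy0 : 0 < y := by linarith
        have e : c₀ / x - c₀ / y = (y - x) * (c₀ / (x * y)) := by field_simp
        rw [e]
        exact mul_le_mul_of_nonneg_left (div_le_div_of_nonneg_left hc₀.le (by positivity)
          (by nlinarith)) (by linarith)
      rcases le_total b c₀ with hb' | hb'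
      · rw [max_eq_right hb', max_eq_right (hab.trans hb'), min_eq_left hb',
          min_eq_left (hab.trans hb')]
        apply le_of_eq; field_simp; ring
      · rcases le_total a c₀ with ha' | ha'
        · rw [max_eq_left hb', max_eq_right ha', min_eq_right hb', min_eq_left ha']
          have h1 := hlog c₀ b le_rfl hb'
          have h2 : (c₀ - a) * (c₀ / b ^ 2) ≤ (c₀ - a) * (c₀ / c₀ ^ 2) :=
            mul_le_mul_of_nonneg_left (div_le_div_of_nonneg_left hc₀.le (by positivity)
              (pow_le_pow_left₀ hc₀.le hb' 2)) (by linarith)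
          have e1 : (b - a) * (c₀ / b ^ 2) = (b - c₀) * (c₀ / b ^ 2) + (c₀ - a) * (c₀ / b ^ 2) := by
            ring
          have e2 : (c₀ - a) * (c₀ / c₀ ^ 2) = c₀ / c₀ - a / c₀ := by field_simp
          linarith
        · rw [max_eq_left hb', max_eq_left ha', min_eq_right hb', min_eq_right ha']
          linarith [hlog a b ha' hab])
    (by simp [hc₀.le, hc₀.ne']) hn
  refine ⟨h1, h2.trans (le_of_eq ?_)⟩
  rw [min_eq_right hc, max_eq_left hc, div_self hc₀.ne']
  ring

end Noise

/-! ### Numerical inequalities for the late-pull budget -/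

section Budget

/-- Tangent line of the logarithm at 1.93, close to the optimal point exp(2/3). -/
theorem one_add_three_log_le {y : ℝ} (hy : 0 < y) : 1 + 3 * Real.log y ≤ 1.56 * y := by
  have h1 : Real.log (y / 1.93) ≤ y / 1.93 - 1 := Real.log_le_sub_one_of_pos (by positivity)
  rw [Real.log_div hy.ne' (by norm_num)] at h1
  have h2 : 3 * Real.log 1.93 ≤ 2 := by
    have h3 : Real.log ((1.93 : ℝ) ^ 3) ≤ 2 := by
      rw [Real.log_le_iff_le_exp (by norm_num)]
      have h4 := Real.exp_one_gt_d9
      have h5 : Real.exp 2 = Real.exp 1 * Real.exp 1 := by rw [← Real.exp_add]; norm_num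
      rw [h5]
      nlinarith
    rwa [Real.log_pow, Nat.cast_ofNat] at h3
  have h6 : y / 1.93 ≤ 0.52 * y := by
    rw [div_le_iff₀ (by norm_num)]
    nlinarith
  linarith

theorem rpow_third_pow_three {x : ℝ} (hx : 0 ≤ x) : (x ^ (1 / 3 : ℝ)) ^ 3 = x := by
  rw [← Real.rpow_natCast, ← Real.rpow_mul hx]
  norm_num

theorem rpow_two_thirds {x : ℝ} (hx : 0 ≤ x) : x ^ (2 / 3 : ℝ) = (x ^ (1 / 3 : ℝ)) ^ 2 := by
  rw [← Real.rpow_natCast, ← Real.rpow_mul hx]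
  norm_num

/-- The right side telescopes in t. With y³ = t + 1 and z³ = t one has y(y² - z²) = 1 - z²(y - z) ≥
2/3, while 1 + log t ≤ 1.56 y; the constants fit because 1.56 = 6 · 0.39 · 2/3. -/
theorem one_add_log_div_le {t : ℝ} (ht : 1 ≤ t) :
    (1 + Real.log t) / (6 * (t + 1) ^ (2 / 3 : ℝ)) ≤
      0.39 * ((t + 1) ^ (2 / 3 : ℝ) - t ^ (2 / 3 : ℝ)) := by
  rw [rpow_two_thirds (by linarith : (0 : ℝ) ≤ t + 1), rpow_two_thirds (by linarith : (0 : ℝ) ≤ t)]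
  have hy0 : 0 < (t + 1) ^ (1 / 3 : ℝ) := Real.rpow_pos_of_pos (by linarith) _
  have hz0 : 0 < t ^ (1 / 3 : ℝ) := Real.rpow_pos_of_pos (by linarith) _
  have hy := rpow_third_pow_three (by linarith : (0 : ℝ) ≤ t + 1)
  have hz := rpow_third_pow_three (by linarith : (0 : ℝ) ≤ t)
  generalize (t + 1) ^ (1 / 3 : ℝ) = y at hy0 hy
  generalize t ^ (1 / 3 : ℝ) = z at hz0 hz
  have hlog : 1 + Real.log t ≤ 1.56 * y := by
    have h1 : Real.log t ≤ Real.log (y ^ 3) := Real.log_le_log (by linarith) (by linarith)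
    rw [Real.log_pow, Nat.cast_ofNat] at h1
    linarith [one_add_three_log_le hy0]
  rw [div_le_iff₀ (by positivity)]
  have hzy : z ≤ y := by
    by_contra hc
    have := pow_lt_pow_left₀ (not_le.1 hc) hy0.le (n := 3) (by norm_num)
    linarith
  have h2 : z ^ 2 * (y - z) ≤ 1 / 3 := by
    have : (y - z) * (y ^ 2 + y * z + z ^ 2) = 1 := by linear_combination hy - hz
    nlinarith [mul_nonneg (sub_nonneg.2 hzy) (sub_nonneg.2 hzy),
      mul_nonneg (mul_nonneg (sub_nonneg.2 hzy) (sub_nonneg.2 hzy)) hz0.le,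
      mul_nonneg (mul_nonneg (sub_nonneg.2 hzy) (sub_nonneg.2 hzy)) hy0.le]
  have h3 : 2 / 3 ≤ y * (y ^ 2 - z ^ 2) := by nlinarith
  nlinarith

/-- The part of the budget `T^{2/3}` that is spent on the confidence threshold, as a function of
`T^{1/3}`. -/
noncomputable def thresholdShare (θ : ℝ) : ℝ :=
  if θ ≤ 9 / 4 then 3 / 4 else if θ ≤ 3 then 7 / 10 else if θ ≤ 4 then 13 / 20
  else if θ ≤ 6 then 3 / 5 else if θ ≤ 8 then 1 / 2 else 9 / 20

theorem thresholdShare_pos (θ : ℝ) : 0 < thresholdShare θ := by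
  unfold thresholdShare; split_ifs <;> norm_num

theorem thresholdShare_lt_one (θ : ℝ) : thresholdShare θ < 1 := by
  unfold thresholdShare; split_ifs <;> norm_num

/-- Limits how fast the late cost grows when ε^v eats into the share b. The quantity b²θ² - θ + 1 is
the lower bound for X bθ² that is available in `late_budget`. -/
theorem thresholdShare_slope {θ : ℝ} (hθ : 1 ≤ θ) :
    0 < thresholdShare θ ^ 2 * θ ^ 2 - θ + 1 ∧
    thresholdShare θ * (2 * θ - thresholdShare θ) ^ 3 ≤
      12 * θ * (thresholdShare θ ^ 2 * θ ^ 2 - θ + 1) ^ 2 := by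
  unfold thresholdShare
  split_ifs with h1 h2 h3 h4 h5
  · refine ⟨by nlinarith, ?_⟩
    obtain ⟨x, hx, rfl⟩ : ∃ x, 0 ≤ x ∧ θ = 1 + x := ⟨θ - 1, by linarith, by ring⟩
    nlinarith [pow_nonneg hx 3, pow_nonneg hx 4, pow_nonneg hx 5, sq_nonneg (x ^ 2 - 1 / 4),
      mul_nonneg hx (sq_nonneg (x - 1 / 2)), sq_nonneg (x - 1 / 2)]
  · refine ⟨by nlinarith, ?_⟩
    -- Shifted to the left end of the piece, the difference of the two sides is a polynomial with
    -- nonnegative coefficients; the same happens on the later pieces.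
    obtain ⟨x, hx, rfl⟩ : ∃ x, 0 ≤ x ∧ θ = 9 / 4 + x := ⟨θ - 9 / 4, by linarith, by ring⟩
    rw [← sub_nonneg]
    ring_nf
    positivity
  · refine ⟨by nlinarith, ?_⟩
    obtain ⟨x, hx, rfl⟩ : ∃ x, 0 ≤ x ∧ θ = 3 + x := ⟨θ - 3, by linarith, by ring⟩
    rw [← sub_nonneg]
    ring_nf
    positivity
  · refine ⟨by nlinarith, ?_⟩
    obtain ⟨x, hx, rfl⟩ : ∃ x, 0 ≤ x ∧ θ = 4 + x := ⟨θ - 4, by linarith, by ring⟩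
    rw [← sub_nonneg]
    ring_nf
    positivity
  · refine ⟨by nlinarith, ?_⟩
    obtain ⟨x, hx, rfl⟩ : ∃ x, 0 ≤ x ∧ θ = 6 + x := ⟨θ - 6, by linarith, by ring⟩
    rw [← sub_nonneg]
    ring_nf
    positivity
  · refine ⟨by nlinarith, ?_⟩
    obtain ⟨x, hx, rfl⟩ : ∃ x, 0 ≤ x ∧ θ = 8 + x := ⟨θ - 8, by linarith, by ring⟩
    rw [← sub_nonneg]
    ring_nf
    positivity

theorem bernstein_nonneg {lo hi v : ℝ} (h0 : lo ≤ v) (h1 : v ≤ hi) (i : ℕ) :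
    0 ≤ (v - lo) ^ i * (hi - v) ^ (9 - i) :=
  mul_nonneg (pow_nonneg (sub_nonneg.2 h0) _) (pow_nonneg (sub_nonneg.2 h1) _)

/-- The late cost, divided by θ², when ε^v = 0; here v³ = η/θ³. On each piece the square root c is
replaced by a bound affine in v³, which leaves a polynomial inequality of degree 9 in v, certified
by Bernstein polynomials. -/
theorem thresholdShare_budget {θ v c : ℝ} (hθ : 1 ≤ θ) (hv : 0 ≤ v) (hv1 : v ≤ 1)
    (h : c ^ 2 * θ = v ^ 3 * θ - thresholdShare θ) :
    0.39 * (1 - v ^ 2) + (1 - v ^ 3) * (2 - v ^ 3) * c / (6 * thresholdShare θ) ≤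
      1 - thresholdShare θ := by
  -- AM-GM in the form 2c ≤ c²/q + q with a free q, and θ replaced by the right end θ₁ of its piece.
  -- Since c² ≥ 0, also v³ ≥ b/θ₁, which gives the left end of the interval for v.
  have key : ∀ b θ₁ q : ℝ, 0 < q → 0 < b → θ ≤ θ₁ → c ^ 2 * θ = v ^ 3 * θ - b →
      c ≤ ((v ^ 3 - b / θ₁) / q + q) / 2 ∧ b / θ₁ ≤ v ^ 3 := by
    intro b θ₁ q hq hb hle h
    have h1 : c ^ 2 = v ^ 3 - b / θ := by field_simp; linarith
    have h2 : b / θ₁ ≤ b / θ := div_le_div_of_nonneg_left hb.le (by linarith) hle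
    refine ⟨?_, by nlinarith [sq_nonneg c]⟩
    have h3 : c ^ 2 / q ≤ (v ^ 3 - b / θ₁) / q := div_le_div_of_nonneg_right (by linarith) hq.le
    have h4 : 2 * c ≤ c ^ 2 / q + q := by
      have : c ^ 2 / q + q - 2 * c = (c - q) ^ 2 / q := by field_simp; ring
      nlinarith [div_nonneg (sq_nonneg (c - q)) hq.le]
    linarith
  have hv3 : v ^ 3 ≤ 1 := pow_le_one₀ hv hv1
  have hpos : 0 ≤ (1 - v ^ 3) * (2 - v ^ 3) := mul_nonneg (by linarith) (by linarith)
  unfold thresholdShare at h ⊢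
  split_ifs at h ⊢ with h1 h2 h3 h4 h5
  · obtain ⟨h6, h7⟩ := key _ (9 / 4) (1 / 4) (by norm_num) (by norm_num) h1 h
    refine (add_le_add le_rfl (div_le_div_of_nonneg_right (mul_le_mul_of_nonneg_left h6 hpos)
      (by norm_num))).trans ?_
    have hlo : 69 / 100 ≤ v := le_of_pow_le_pow_left₀ three_ne_zero hv (by norm_num at h7 ⊢; linarith)
    have hB := bernstein_nonneg hlo hv1
    norm_num only
    linarith [hB 0, hB 1, hB 2, hB 3, hB 4, hB 5,
      hB 6, hB 7, hB 8, hB 9]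
  · obtain ⟨h6, h7⟩ := key _ 3 (27 / 100) (by norm_num) (by norm_num) h2 h
    refine (add_le_add le_rfl (div_le_div_of_nonneg_right (mul_le_mul_of_nonneg_left h6 hpos)
      (by norm_num))).trans ?_
    have hlo : 61 / 100 ≤ v := le_of_pow_le_pow_left₀ three_ne_zero hv (by norm_num at h7 ⊢; linarith)
    have hB := bernstein_nonneg hlo hv1
    norm_num only
    linarith [hB 0, hB 1, hB 2, hB 3, hB 4, hB 5,
      hB 6, hB 7, hB 8, hB 9]
  · obtain ⟨h6, h7⟩ := key _ 4 (28 / 100) (by norm_num) (by norm_num) h3 h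
    refine (add_le_add le_rfl (div_le_div_of_nonneg_right (mul_le_mul_of_nonneg_left h6 hpos)
      (by norm_num))).trans ?_
    have hlo : 54 / 100 ≤ v := le_of_pow_le_pow_left₀ three_ne_zero hv (by norm_num at h7 ⊢; linarith)
    have hB := bernstein_nonneg hlo hv1
    norm_num only
    linarith [hB 0, hB 1, hB 2, hB 3, hB 4, hB 5,
      hB 6, hB 7, hB 8, hB 9]
  · obtain ⟨h6, h7⟩ := key _ 6 (3 / 10) (by norm_num) (by norm_num) h4 h
    refine (add_le_add le_rfl (div_le_div_of_nonneg_right (mul_le_mul_of_nonneg_left h6 hpos)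
      (by norm_num))).trans ?_
    have hlo : 46 / 100 ≤ v := le_of_pow_le_pow_left₀ three_ne_zero hv (by norm_num at h7 ⊢; linarith)
    have hB := bernstein_nonneg hlo hv1
    norm_num only
    linarith [hB 0, hB 1, hB 2, hB 3, hB 4, hB 5,
      hB 6, hB 7, hB 8, hB 9]
  · obtain ⟨h6, h7⟩ := key _ 8 (3 / 10) (by norm_num) (by norm_num) h5 h
    refine (add_le_add le_rfl (div_le_div_of_nonneg_right (mul_le_mul_of_nonneg_left h6 hpos)
      (by norm_num))).trans ?_
    have hlo : 39 / 100 ≤ v := le_of_pow_le_pow_left₀ three_ne_zero hv (by norm_num at h7 ⊢; linarith)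
    have hB := bernstein_nonneg hlo hv1
    norm_num only
    linarith [hB 0, hB 1, hB 2, hB 3, hB 4, hB 5,
      hB 6, hB 7, hB 8, hB 9]
  -- The last piece is unbounded in θ, so b/θ is dropped and v ranges over all of [0,1].
  · have h6 : c ≤ (v ^ 3 / (36 / 100) + 36 / 100) / 2 := by
      have h1 : c ^ 2 ≤ v ^ 3 := by nlinarith
      nlinarith [sq_nonneg (c - 36 / 100)]
    refine (add_le_add le_rfl (div_le_div_of_nonneg_right (mul_le_mul_of_nonneg_left h6 hpos)
      (by norm_num))).trans ?_
    have hB := bernstein_nonneg hv hv1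
    simp only [sub_zero] at hB
    have h0 := hB 0
    have h1 := hB 1
    have h2 := hB 2
    have h3 := hB 3
    have h4 := hB 4
    have h5 := hB 5
    have h6 := hB 6
    have h7 := hB 7
    have h8 := hB 8
    have h9 := hB 9
    clear hB
    norm_num at h0 h1 h2 h3 h4 h5 h6 h7 h8 h9 ⊢
    linarith

/-- The secant slope of (m - X)/(X(X + C)) between X and b is at most the one for C = 0, which is
then enlarged using X ≤ b ≤ m. -/
theorem secant_width_le {b m X C : ℝ} (hb : 0 < b) (hX : 0 < X) (hC : 0 ≤ C) (hXb : X ≤ b)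
    (hbm : b ≤ m) : (m - X) / (X * (X + C)) ≤
      (m - b) / (b * (b + C)) + (b - X) * ((2 * m * b - b ^ 2) / (X * b) ^ 2) := by
  have hm : 0 < m := by linarith
  have h1 : (m - X) / (X * (X + C)) = (m - b) / (b * (b + C)) +
      (b - X) * ((m * (b + X + C) - X * b) / (X * (X + C) * (b * (b + C)))) := by
    have : X + C ≠ 0 := by positivity
    have : b + C ≠ 0 := by positivity
    field_simp
    ring
  rw [h1]
  refine add_le_add le_rfl (mul_le_mul_of_nonneg_left ?_ (by linarith))
  have h2 : (m * (b + X + C) - X * b) / (X * (X + C) * (b * (b + C))) ≤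
      (m * (b + X) - X * b) / (X * b) ^ 2 := by
    rw [div_le_div_iff₀ (by positivity) (by positivity)]
    have e : (m * (b + X) - X * b) * (X * (X + C) * (b * (b + C))) -
        (m * (b + X + C) - X * b) * (X * b) ^ 2 =
        X * b * C * (m * (b ^ 2 + b * X + X ^ 2) - X * b * (X + b) +
          C * (m * (b + X) - X * b)) := by ring
    have h3 : 0 ≤ m * (b + X) - X * b := by nlinarith
    have h4 : 0 ≤ m * (b ^ 2 + b * X + X ^ 2) - X * b * (X + b) := by
      nlinarith [mul_nonneg (sub_nonneg.2 hbm) (by positivity : 0 ≤ b ^ 2 + b * X + X ^ 2),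
        pow_pos hb 3]
    have h5 : 0 ≤ X * b * C * (m * (b ^ 2 + b * X + X ^ 2) - X * b * (X + b) +
          C * (m * (b + X) - X * b)) :=
      mul_nonneg (by positivity) (add_nonneg h4 (mul_nonneg hC h3))
    linarith
  refine h2.trans (div_le_div_of_nonneg_right ?_ (by positivity))
  nlinarith

/-- Dropping the summand b in b + 4mc leaves c²/(4c) after m cancels. -/
theorem width_at_share_le {b m c θ : ℝ} (hb : 0 < b) (hm : 0 < m) (hc : 0 ≤ c) (hθ : 0 < θ)
    (hcw : c ^ 2 * θ = m - b) :
    m * ((m - b) / (b * (b + 4 * m * c))) / θ ≤ c / (4 * b) := by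
  rw [← hcw, div_le_iff₀ hθ, mul_div_assoc', div_le_iff₀ (by positivity)]
  have : c / (4 * b) * θ * (b * (b + 4 * m * c)) = c * θ * (b + 4 * m * c) / 4 := by
    field_simp
  rw [this]
  nlinarith [mul_nonneg (mul_nonneg hb.le hc) hθ.le]

/-- AM-GM on 2(θ - m) and 2m - b, whose sum is 2θ - b, and m ≥ b remove m from the cubic; what
remains is `thresholdShare_slope`. -/
theorem slope_le {b m X N θ : ℝ} (hb : 0 < b) (hX : 0 < X) (hθ : 0 < θ) (hm : 0 < m)
    (hbm : b ≤ m) (hmθ : m ≤ θ) (hN : 0 < N) (hXN : N ≤ X * (b * θ ^ 2))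
    (hslope : b * (2 * θ - b) ^ 3 / 12 ≤ θ * N ^ 2) :
    2 / 3 * ((1 - m / θ) * (2 - m / θ)) / θ * (m * ((2 * m * b - b ^ 2) / (X * b) ^ 2)) ≤
      m * θ ^ 2 := by
  have h1 : N ^ 2 ≤ (X * b) ^ 2 * θ ^ 4 := by
    have : N ^ 2 ≤ (X * (b * θ ^ 2)) ^ 2 := pow_le_pow_left₀ hN.le hXN 2
    nlinarith
  have h2 : 2 / 3 * ((θ - m) * (2 * θ - m)) * (2 * m * b - b ^ 2) ≤ θ * N ^ 2 := by
    have h3 : (θ - m) * (2 * m - b) ≤ (2 * θ - b) ^ 2 / 8 := by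
      nlinarith [sq_nonneg (2 * (θ - m) - (2 * m - b))]
    have h4 : (θ - m) * (2 * m - b) * (2 * θ - m) ≤ (2 * θ - b) ^ 2 / 8 * (2 * θ - b) :=
      mul_le_mul h3 (by linarith) (by linarith) (by positivity)
    calc 2 / 3 * ((θ - m) * (2 * θ - m)) * (2 * m * b - b ^ 2)
        = 2 / 3 * (b * ((θ - m) * (2 * m - b) * (2 * θ - m))) := by ring
      _ ≤ 2 / 3 * (b * ((2 * θ - b) ^ 2 / 8 * (2 * θ - b))) :=
          mul_le_mul_of_nonneg_left (mul_le_mul_of_nonneg_left h4 hb.le) (by norm_num)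
      _ = b * (2 * θ - b) ^ 3 / 12 := by ring
      _ ≤ θ * N ^ 2 := hslope
  have hq : 0 < (X * b) ^ 2 := by positivity
  generalize (X * b) ^ 2 = q at *
  have h3 := h2.trans (mul_le_mul_of_nonneg_left h1 hθ.le)
  have e1 : 2 / 3 * ((1 - m / θ) * (2 - m / θ)) / θ * (m * ((2 * m * b - b ^ 2) / q)) =
      m * (2 / 3 * ((θ - m) * (2 * θ - m)) * (2 * m * b - b ^ 2)) / (θ ^ 3 * q) := by
    field_simp
  rw [e1, div_le_iff₀ (by positivity)]
  nlinarith [mul_le_mul_of_nonneg_left h3 hm.le]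

/-- `late_budget` divided by θ², with X the part of b that survives the correction by ε^v. At X = b
it is `thresholdShare_budget`; each unit lost from b costs at most mθ², which the right side allows.
-/
theorem tail_cost_le {θ v c m X : ℝ} (hθ : 1 ≤ θ) (hv : 0 ≤ v) (hm : v ^ 3 * θ = m)
    (hmb : thresholdShare θ ≤ m) (hmθ : m ≤ θ) (hc : 0 ≤ c)
    (hcw : c ^ 2 * θ = m - thresholdShare θ) (hXb : X ≤ thresholdShare θ)
    (hX : thresholdShare θ ^ 2 * θ ^ 2 - θ + 1 ≤ X * (thresholdShare θ * θ ^ 2)) :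
    0 < X ∧ 0.39 * (1 - v ^ 2) +
      2 / 3 * (1 - v ^ 3) * (2 - v ^ 3) / θ * (m * (m - X) / (X * (X + 4 * m * c))) ≤
      1 - thresholdShare θ + (thresholdShare θ - X) * (m * θ ^ 2) := by
  have hb := thresholdShare_pos θ
  obtain ⟨hN, hslope⟩ := thresholdShare_slope hθ
  have hv1 : v ≤ 1 := by
    refine le_of_pow_le_pow_left₀ three_ne_zero zero_le_one ?_
    rw [one_pow]
    by_contra hc
    nlinarith [not_le.1 hc]
  have hbudget := thresholdShare_budget hθ hv hv1 (by rw [hm]; exact hcw)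
  generalize thresholdShare θ = b at *
  have hθ0 : 0 < θ := by linarith
  have hX0 : 0 < X := by
    by_contra hc
    have : X * (b * θ ^ 2) ≤ 0 := mul_nonpos_of_nonpos_of_nonneg (not_lt.1 hc) (by positivity)
    linarith
  refine ⟨hX0, ?_⟩
  have hm0 : 0 < m := by linarith
  have hv3 : v ^ 3 = m / θ := by rw [← hm]; field_simp
  have hv31 : v ^ 3 ≤ 1 := pow_le_one₀ hv hv1
  have hA : 0 ≤ (1 - v ^ 3) * (2 - v ^ 3) := mul_nonneg (by linarith) (by linarith)
  have hsec := secant_width_le (C := 4 * m * c) hb hX0 (by positivity) hXb hmb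
  have hwid := width_at_share_le hb hm0 hc hθ0 hcw
  have hsl := slope_le hb hX0 hθ0 hm0 hmb hmθ hN hX (by linarith)
  rw [← hv3] at hsl
  set B := (1 - v ^ 3) * (2 - v ^ 3) with hB
  set D1 := (m - b) / (b * (b + 4 * m * c))
  set D2 := (2 * m * b - b ^ 2) / (X * b) ^ 2
  have h6 := mul_le_mul_of_nonneg_left hsec (by positivity : 0 ≤ 2 / 3 * B / θ * m)
  have h7 := mul_le_mul_of_nonneg_left hsl (sub_nonneg.2 hXb)
  have h9 := mul_le_mul_of_nonneg_left hwid (by positivity : 0 ≤ 2 / 3 * B)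
  have h8 : 2 / 3 * (1 - v ^ 3) * (2 - v ^ 3) / θ * (m * (m - X) / (X * (X + 4 * m * c))) =
      2 / 3 * B / θ * m * ((m - X) / (X * (X + 4 * m * c))) := by rw [hB]; ring
  have h10 : B * c / (6 * b) = 2 / 3 * B * (c / (4 * b)) := by field_simp; ring
  have h11 : 2 / 3 * B * (m * D1 / θ) = 2 / 3 * B / θ * m * D1 := by ring
  have h12 : (b - X) * (2 / 3 * B / θ * (m * D2)) = 2 / 3 * B / θ * m * ((b - X) * D2) := by ring
  rw [h8]
  rw [h12] at h7
  rw [h11, ← h10] at h9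
  rw [mul_add _ D1] at h6
  linarith

/-- Bound on the expected number of late pulls for one agent: `w = 6ρ/(MΔ²)`, `η` is the
threshold for the consensus count and `s` the squared ratio of confidence width and gap there. -/
theorem late_budget {θ w e c : ℝ} (hθ : 1 ≤ θ) (hw : 0 ≤ w) (he : 0 ≤ e) (hc : 0 ≤ c)
    (hcw : c ^ 2 * θ = w) (hsmall : w * e < θ - 1 - w) {η s : ℝ}
    (hη : η = (w + thresholdShare θ) * θ ^ 2) (hs : s = w * θ ^ 2 * (η + e) / η ^ 2) :
    s < 1 ∧ η ≤ θ ^ 3 ∧ 0.39 * (θ ^ 2 - η ^ (2 / 3 : ℝ)) + (θ ^ 3 - η) *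
      ((2 - η / θ ^ 3) * s / (6 * θ ^ 2 * (((1 - s) / 2) ^ 2 + 2 * ((1 - s) / 2) * c))) ≤
      θ ^ 2 * (1 - thresholdShare θ) + w * θ ^ 2 * e := by
  have hb := thresholdShare_pos θ
  have hb1 := thresholdShare_lt_one θ
  have hθ0 : 0 < θ := by linarith
  have hwe : 0 ≤ w * e := mul_nonneg hw he
  have hη0 : 0 < η := by rw [hη]; positivity
  set b := thresholdShare θ with hbdef
  set m := w + b with hmdef
  have hm0 : 0 < m := by positivity
  have hmθ : m ≤ θ := by linarith
  set z := η ^ (1 / 3 : ℝ) with hz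
  have hz3 : z ^ 3 = η := rpow_third_pow_three hη0.le
  have hz0 : 0 < z := Real.rpow_pos_of_pos hη0 _
  obtain ⟨hX0, hcost⟩ := tail_cost_le (v := z / θ) (c := c) (m := m) (X := b - w * e / η) hθ
    (by positivity) (by rw [div_pow, hz3, hη]; field_simp) (by linarith) hmθ hc
    (by rw [hcw, hmdef]; ring) (by have := div_nonneg hwe hη0.le; linarith) (by
      -- As bθ² ≤ η, the loss is at most w e, which is below θ - 1 - w by `hsmall`.
      have h1 : w * e / η * (b * θ ^ 2) ≤ w * e := by
        rw [div_mul_eq_mul_div, div_le_iff₀ hη0]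
        refine mul_le_mul_of_nonneg_left ?_ hwe
        rw [hη]
        exact mul_le_mul_of_nonneg_right (by linarith) (by positivity)
      rw [← hbdef]
      nlinarith)
  rw [← hbdef] at hcost
  set X := b - w * e / η with hXdef
  -- With η = mθ² one has s = w/m + w e/(mη), and m - w = b.
  have hs1 : 1 - s = X / m := by
    rw [hs, hXdef, hη, hmdef]
    field_simp
    ring
  have hs2 : s = 1 - X / m := by linarith
  have hy : η / θ ^ 3 = (z / θ) ^ 3 := by rw [div_pow, hz3]
  have hηm : η = m * θ ^ 2 := hη
  refine ⟨by have := div_pos hX0 hm0; linarith, ?_, ?_⟩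
  · rw [hηm]; nlinarith [sq_nonneg θ, mul_le_mul_of_nonneg_right hmθ (sq_nonneg θ)]
  · have e1 : η ^ (2 / 3 : ℝ) = θ ^ 2 * (z / θ) ^ 2 := by
      rw [rpow_two_thirds hη0.le, ← hz]; field_simp
    have hXC : 0 < X + 4 * m * c := by positivity
    have e2 : (θ ^ 3 - η) *
        ((2 - η / θ ^ 3) * s / (6 * θ ^ 2 * (((1 - s) / 2) ^ 2 + 2 * ((1 - s) / 2) * c))) =
        θ ^ 2 * (2 / 3 * (1 - (z / θ) ^ 3) * (2 - (z / θ) ^ 3) / θ *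
          (m * (m - X) / (X * (X + 4 * m * c)))) := by
      have e3 : θ ^ 3 - η = θ ^ 3 * (1 - (z / θ) ^ 3) := by rw [← hy]; field_simp
      have e4 : ((1 - s) / 2) ^ 2 + 2 * ((1 - s) / 2) * c = X * (X + 4 * m * c) / (4 * m ^ 2) := by
        rw [hs1]; field_simp; ring
      rw [e3, e4, hy, hs2]
      field_simp
      ring
    have e5 : w * θ ^ 2 * e = θ ^ 2 * ((b - X) * (m * θ ^ 2)) := by
      rw [← hηm, hXdef]; field_simp; ring
    rw [e1, e2, e5]
    have := mul_le_mul_of_nonneg_left hcost (sq_nonneg θ)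
    linarith

end Budget

/-! ### Rewards of one arm as round noise -/

section BanditNoise

variable {V Ω : Type*} {mΩ : MeasurableSpace Ω} {K : ℕ} {ν : Fin K → Measure ℝ}
  {ρ : ℝ} {μ : Measure Ω} {ℱ : Filtration ℕ mΩ} {X : ℕ → V → Fin K → Ω → ℝ} {A : ℕ → V → Ω → Fin K}

theorem IsBanditProcess.isRoundNoise [Fintype V] [∀ k, IsProbabilityMeasure (ν k)] [IsProbabilityMeasure μ]
    (h : IsBanditProcess μ ν ℱ X A) (hν : ∀ k, MemLp id 2 (ν k))
    (hρ : ∀ k, ∫ y, (y - armMean ν k) ^ 2 ∂(ν k) ≤ ρ) (k : Fin K) :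
    IsRoundNoise μ ℱ (fun i d ω => X (i + 1) d k ω - armMean ν k) ρ := by
  have hm : ∀ i d, Measurable (X (i + 1) d k) := fun i d =>
    (h.measurable_reward i d k).mono (ℱ.le _) le_rfl
  have hmap : ∀ i d, μ.map (X (i + 1) d k) = ν k := fun i d => h.law_reward i d k
  have hL : ∀ i d, MemLp (X (i + 1) d k) 2 μ := fun i d => by
    have := (memLp_map_measure_iff (μ := μ) (f := X (i + 1) d k) (g := id) (p := 2)
      aestronglyMeasurable_id (hm i d).aemeasurable).1 (by rw [hmap i d]; exact hν k)
    exact this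
  have hL' : ∀ i d, MemLp (fun ω => X (i + 1) d k ω - armMean ν k) 2 μ := fun i d =>
    (hL i d).sub (memLp_const _)
  have h0 : ∀ i d, ∫ ω, (X (i + 1) d k ω - armMean ν k) ∂μ = 0 := fun i d => by
    rw [integral_sub ((hL i d).integrable one_le_two) (integrable_const _), integral_const]
    have : ∫ ω, X (i + 1) d k ω ∂μ = armMean ν k := by
      rw [armMean, ← hmap i d, integral_map (hm i d).aemeasurable
        (f := fun y => y) aestronglyMeasurable_id]
    simp [this]
  refine ⟨fun i d => (h.measurable_reward i d k).sub_const _, hL', h0, fun i d => ?_,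
    fun i d d' hd => ?_, fun i => ?_⟩
  · refine le_trans (le_of_eq ?_) (hρ k)
    rw [← hmap i d, integral_map (hm i d).aemeasurable (by fun_prop)]
  · have hind : IndepFun (X (i + 1) d k) (X (i + 1) d' k) μ :=
      (h.indep_round i).indepFun (i := (d, k)) (j := (d', k)) (by simpa using hd)
    have hind' := hind.comp (φ := fun y => y - armMean ν k) (ψ := fun y => y - armMean ν k)
      (by fun_prop) (by fun_prop)
    have := hind'.integral_mul_eq_mul_integral (hL' i d).1 (hL' i d').1
    refine this.trans ?_
    have e : ∫ ω, ((fun y => y - armMean ν k) ∘ X (i + 1) d k) ω ∂μ = 0 := h0 i d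
    rw [e, zero_mul]
  · refine indep_of_indep_of_le_left (h.indep_past i) (iSup_le fun d => ?_)
    refine le_trans ?_ (le_iSup (fun j : V × Fin K =>
      MeasurableSpace.comap (X (i + 1) j.1 j.2) inferInstance) (d, k))
    exact ((comap_measurable (X (i + 1) d k)).sub_const _).comap_le

theorem IsBanditProcess.measurable_pullVec (h : IsBanditProcess μ ν ℱ X A) (k : Fin K) (i : ℕ)
    (d : V) : Measurable[ℱ i] fun ω => pullVec (fun t v => A t v ω) k (i + 1) d :=
  Measurable.ite (h.measurable_action i d (measurableSet_singleton k)) measurable_const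
    measurable_const

end BanditNoise

/-! ### Second-moment bounds for the consensus estimates -/

section Concentration

variable {V Ω : Type*} [Fintype V] [DecidableEq V] {mΩ : MeasurableSpace Ω}
  {G : SimpleGraph V} [DecidableRel G.Adj] {κ : ℝ} {lam : Fin (Fintype.card V) → ℝ}
  {u : OrthonormalBasis (Fin (Fintype.card V)) ℝ (EuclideanSpace ℝ V)}
  {K : ℕ} {ν : Fin K → Measure ℝ} {ρ : ℝ} {μ : Measure Ω} {ℱ : Filtration ℕ mΩ}
  {X : ℕ → V → Fin K → Ω → ℝ} {A : ℕ → V → Ω → Fin K}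

/-- Deviation of the consensus reward sum of arm `k` from its conditional mean. -/
noncomputable def deviation (P : Matrix V V ℝ) (ν : Fin K → Measure ℝ) (X : ℕ → V → Fin K → Ω → ℝ)
    (A : ℕ → V → Ω → Fin K) (k : Fin K) (t : ℕ) (v : V) (ω : Ω) : ℝ :=
  sHat P (fun t v => A t v ω) (fun t v => X t v (A t v ω) ω) k t v -
    armMean ν k * nHat P (fun t v => A t v ω) k t v

/-- The indicator vanishes unless arm k is pulled, so the received reward may be replaced by the
reward of arm k, whose noise is independent of the past. -/
theorem deviation_eq_weightedNoise (P : Matrix V V ℝ) (k : Fin K) (t : ℕ) (v : V) (ω : Ω) :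
    deviation P ν X A k t v ω =
      weightedNoise (fun i d ω => (P ^ (t - i)) v d * pullVec (fun t v => A t v ω) k (i + 1) d)
        (fun i d ω => X (i + 1) d k ω - armMean ν k) t ω := by
  rw [deviation, sHat_sub_eq_sum, weightedNoise]
  refine Finset.sum_congr rfl fun i _ => Finset.sum_congr rfl fun d _ => ?_
  rw [mul_assoc]
  congr 1
  by_cases h : A (i + 1) d ω = k <;> simp [pullVec, h]

theorem abs_pow_mul_pullVec_le_one {P : Matrix V V ℝ} (hP : P ∈ Matrix.rowStochastic ℝ V)
    (a : ℕ → V → Fin K) (k : Fin K) (n i : ℕ) (v d : V) :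
    |(P ^ n) v d * pullVec a k i d| ≤ 1 := by
  have hn := pow_mem hP n
  have h0 := Matrix.nonneg_of_mem_rowStochastic hn (i := v) (j := d)
  rw [abs_of_nonneg (mul_nonneg h0 (pullVec_nonneg a k i d))]
  exact mul_le_one₀ (Matrix.le_one_of_mem_rowStochastic hn) (pullVec_nonneg a k i d)
    (pullVec_le_one a k i d)

variable [∀ k, IsProbabilityMeasure (ν k)] [IsProbabilityMeasure μ]

/-- Cutoff c₀ = (1 + ε^v)/M in the logarithmic potential. The majorant is nonnegative everywhere, so
its expectation needs no conditioning on n̂ ≥ 1; and (t + ε^v)/(1 + ε^v) ≤ t. -/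
theorem exists_deviation_bound_log (hG : G.Connected) (hκ : 0 < κ)
    (hP : consensusMatrix G κ ∈ Matrix.rowStochastic ℝ V)
    (hu : IsOrderedEigenbasis (consensusMatrix G κ) lam u) (hXA : IsBanditProcess μ ν ℱ X A)
    (hν : ∀ k, MemLp id 2 (ν k)) (hρ : ∀ k, ∫ y, (y - armMean ν k) ^ 2 ∂(ν k) ≤ ρ) (hρ0 : 0 ≤ ρ)
    (k : Fin K) {t : ℕ} (ht : 1 ≤ t) (v : V) :
    ∃ Y : Ω → ℝ, Integrable Y μ ∧ (∀ ω, 0 ≤ Y ω) ∧ ∫ ω, Y ω ∂μ ≤ ρ * (1 + Real.log t) ∧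
      ∀ ω, 1 ≤ nHat (consensusMatrix G κ) (fun t v => A t v ω) k t v →
        deviation (consensusMatrix G κ) ν X A k t v ω ^ 2 * (Fintype.card V /
          (nHat (consensusMatrix G κ) (fun t v => A t v ω) k t v + agentEps lam u v)) ≤ Y ω := by
  have he := agentEps_nonneg hG hκ hP hu v
  have hM : (0 : ℝ) < Fintype.card V := by
    have : Nonempty V := ⟨v⟩
    exact_mod_cast Fintype.card_pos
  have ht' : (1 : ℝ) ≤ t := by exact_mod_cast ht
  set e := agentEps lam u v with hedef
  set Z : ℕ → V → Ω → ℝ := fun i d ω =>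
    (consensusMatrix G κ ^ (t - i)) v d * pullVec (fun t v => A t v ω) k (i + 1) d with hZ
  have hV : ∀ ω, sqWeights Z t ω ≤
      (nHat (consensusMatrix G κ) (fun t v => A t v ω) k t v + e) / Fintype.card V := fun ω =>
    sum_sq_weights_le hG hκ hP hu _ k t v
  obtain ⟨h1, h2⟩ := (hXA.isRoundNoise hν hρ k).integral_sq_div_max_le hρ0 (Z := Z)
    (fun i d => (hXA.measurable_pullVec k i d).const_mul _)
    (fun i d ω => abs_pow_mul_pullVec_le_one hP _ k _ _ v d) (c₀ := (1 + e) / Fintype.card V)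
    (c := (t + e) / Fintype.card V) (by positivity) (by gcongr) (n := t)
    (fun ω => (hV ω).trans (by gcongr; exact nHat_le hP _ k t v))
  have hpos : ∀ x, 0 < max x ((1 + e) / Fintype.card V) := fun x =>
    lt_max_of_lt_right (by positivity)
  refine ⟨_, h1, fun ω => mul_nonneg (sq_nonneg _) (inv_pos.2 (hpos _)).le, h2.trans ?_,
    fun ω hω => ?_⟩
  · refine mul_le_mul_of_nonneg_left (add_le_add le_rfl (Real.log_le_log (by positivity) ?_)) hρ0
    rw [div_div_div_cancel_right₀ hM.ne', div_le_iff₀ (by positivity)]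
    nlinarith
  · rw [deviation_eq_weightedNoise, ← inv_div]
    refine mul_le_mul_of_nonneg_left (inv_anti₀ (hpos _) (max_le (hV ω) ?_)) (sq_nonneg _)
    gcongr

/-- Cutoff c₀ = (η + ε^v)/M in the bounded potential, rescaled; the majorant works because (η +
e)/(η(n + e)) ≥ 1/n for n ≥ η. -/
theorem exists_deviation_bound_const (hG : G.Connected) (hκ : 0 < κ)
    (hP : consensusMatrix G κ ∈ Matrix.rowStochastic ℝ V)
    (hu : IsOrderedEigenbasis (consensusMatrix G κ) lam u) (hXA : IsBanditProcess μ ν ℱ X A)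
    (hν : ∀ k, MemLp id 2 (ν k)) (hρ : ∀ k, ∫ y, (y - armMean ν k) ^ 2 ∂(ν k) ≤ ρ) (hρ0 : 0 ≤ ρ)
    (k : Fin K) {t : ℕ} (v : V) {η : ℝ} (hη : 0 < η) (hηt : η ≤ t) :
    ∃ Y : Ω → ℝ, Integrable Y μ ∧ (∀ ω, 0 ≤ Y ω) ∧
      ∫ ω, Y ω ∂μ ≤ (η + agentEps lam u v) / (Fintype.card V * η ^ 2) * (ρ * (2 - η / t)) ∧
      ∀ ω, η ≤ nHat (consensusMatrix G κ) (fun t v => A t v ω) k t v →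
        (deviation (consensusMatrix G κ) ν X A k t v ω /
          nHat (consensusMatrix G κ) (fun t v => A t v ω) k t v) ^ 2 ≤ Y ω := by
  have he := agentEps_nonneg hG hκ hP hu v
  have hM : (0 : ℝ) < Fintype.card V := by
    have : Nonempty V := ⟨v⟩
    exact_mod_cast Fintype.card_pos
  set e := agentEps lam u v with hedef
  set Z : ℕ → V → Ω → ℝ := fun i d ω =>
    (consensusMatrix G κ ^ (t - i)) v d * pullVec (fun t v => A t v ω) k (i + 1) d with hZ
  have hV : ∀ ω, sqWeights Z t ω ≤
      (nHat (consensusMatrix G κ) (fun t v => A t v ω) k t v + e) / Fintype.card V := fun ω =>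
    sum_sq_weights_le hG hκ hP hu _ k t v
  obtain ⟨h1, h2⟩ := (hXA.isRoundNoise hν hρ k).integral_sq_div_max_sq_le hρ0 (Z := Z)
    (fun i d => (hXA.measurable_pullVec k i d).const_mul _)
    (fun i d ω => abs_pow_mul_pullVec_le_one hP _ k _ _ v d) (c₀ := (η + e) / Fintype.card V)
    (c := (t + e) / Fintype.card V) (by positivity) (by gcongr) (n := t)
    (fun ω => (hV ω).trans (by gcongr; exact nHat_le hP _ k t v))
  have hpos : ∀ x, 0 < max x ((η + e) / Fintype.card V) := fun x =>
    lt_max_of_lt_right (by positivity)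
  have ht : (0 : ℝ) < t := hη.trans_le hηt
  refine ⟨_, h1.const_mul ((η + e) / (Fintype.card V * η ^ 2)), fun ω => mul_nonneg (by positivity)
    (mul_nonneg (sq_nonneg _) (div_nonneg (by positivity) (sq_nonneg _))), ?_, fun ω hω => ?_⟩
  · rw [integral_const_mul]
    refine mul_le_mul_of_nonneg_left (h2.trans ?_) (by positivity)
    refine mul_le_mul_of_nonneg_left (sub_le_sub_left ?_ _) hρ0
    rw [div_div_div_cancel_right₀ hM.ne', div_le_div_iff₀ ht (by positivity)]
    nlinarith
  · rw [deviation_eq_weightedNoise]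
    set n := nHat (consensusMatrix G κ) (fun t v => A t v ω) k t v with hn
    have hn0 : 0 < n := hη.trans_le hω
    rw [div_pow, mul_left_comm, div_eq_mul_inv]
    refine mul_le_mul_of_nonneg_left ?_ (sq_nonneg _)
    have hmax : max (sqWeights Z t ω) ((η + e) / Fintype.card V) ≤ (n + e) / Fintype.card V :=
      max_le (hV ω) (by gcongr)
    have h3 : (η + e) / Fintype.card V / ((n + e) / Fintype.card V) ^ 2 ≤
        (η + e) / Fintype.card V / max (sqWeights Z t ω) ((η + e) / Fintype.card V) ^ 2 :=
      div_le_div_of_nonneg_left (by positivity) (pow_pos (hpos _) 2)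
        (pow_le_pow_left₀ (hpos _).le hmax 2)
    refine le_trans ?_ (mul_le_mul_of_nonneg_left h3 (by positivity))
    have e1 : (η + e) / (Fintype.card V * η ^ 2) *
        ((η + e) / Fintype.card V / ((n + e) / Fintype.card V) ^ 2) =
        ((η + e) / (η * (n + e))) ^ 2 := by
      field_simp
    rw [e1, ← inv_pow]
    refine pow_le_pow_left₀ (by positivity) ?_ 2
    rw [inv_eq_one_div, div_le_div_iff₀ hn0 (by positivity)]
    nlinarith

end Concentration

/-! ### What a late pull implies -/

section LatePulls

/-- If an arm with gap `Δ` has the larger upper confidence bound, one of the two empirical means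
is off: `D₀`, `C₀` are deviation and confidence width of the best arm, `D₁`, `C₁` those of the
other one. -/
theorem one_le_of_index_le {Δ D₀ C₀ D₁ C₁ s c : ℝ} (hΔ : 0 < Δ) (hs : s < 1) (hc : 0 ≤ c)
    (hC₀ : 0 < C₀) (hC₀c : Δ * c ≤ C₀) (hC₁ : C₁ ^ 2 ≤ Δ ^ 2 * s) (h : Δ + D₀ + C₀ ≤ D₁ + C₁) :
    1 ≤ D₀ ^ 2 / C₀ ^ 2 +
      D₁ ^ 2 / (Δ ^ 2 * (((1 - s) / 2) ^ 2 + 2 * ((1 - s) / 2) * c)) := by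
  set a := (1 - s) / 2 with ha
  have ha0 : 0 < a := by rw [ha]; linarith
  have hs0 : 0 ≤ s := by
    by_contra hs0
    nlinarith [sq_nonneg C₁, mul_pos hΔ hΔ]
  -- √s ≤ (1 + s)/2 = 1 - a, so half of 1 - s remains as slack.
  have hC₁' : C₁ ≤ Δ * (1 - a) := by
    refine abs_le_of_sq_le_sq' ?_ (mul_nonneg hΔ.le (by rw [ha]; linarith)) |>.2
    have : s ≤ (1 - a) ^ 2 := by rw [ha]; nlinarith [sq_nonneg (1 - s)]
    nlinarith [mul_le_mul_of_nonneg_left this (sq_nonneg Δ)]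
  set z := 1 + D₀ / C₀ with hz
  have hD₀ : D₀ = C₀ * (z - 1) := by rw [hz]; field_simp; ring
  have e1 : D₀ ^ 2 / C₀ ^ 2 = (z - 1) ^ 2 := by rw [hD₀]; field_simp
  have hq : 0 < Δ ^ 2 * (a ^ 2 + 2 * a * c) := by positivity
  rw [e1]
  rcases le_or_gt z 0 with hz0 | hz0
  · have := div_nonneg (sq_nonneg D₁) hq.le
    nlinarith
  have hD₁ : Δ * (a + c * z) ≤ D₁ := by nlinarith [mul_le_mul_of_nonneg_right hC₀c hz0.le]
  have h1 : (Δ * (a + c * z)) ^ 2 ≤ D₁ ^ 2 := pow_le_pow_left₀ (by positivity) hD₁ 2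
  have h2 : 1 - (z - 1) ^ 2 ≤ D₁ ^ 2 / (Δ ^ 2 * (a ^ 2 + 2 * a * c)) := by
    rw [le_div_iff₀ hq]
    refine le_trans ?_ h1
    -- Identity: (a + cz)² - (a² + 2ac)(1 - (z - 1)²) = (a(1 - z) - cz)².
    nlinarith [mul_nonneg (sq_nonneg Δ) (sq_nonneg (a * (1 - z) - c * z))]
  linarith

variable {V Ω : Type*} [Fintype V] [DecidableEq V] {mΩ : MeasurableSpace Ω}
  {G : SimpleGraph V} [DecidableRel G.Adj] {κ : ℝ} {lam : Fin (Fintype.card V) → ℝ}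
  {u : OrthonormalBasis (Fin (Fintype.card V)) ℝ (EuclideanSpace ℝ V)}
  {K : ℕ} {ν : Fin K → Measure ℝ} {ρ : ℝ} {μ : Measure Ω} {ℱ : Filtration ℕ mΩ}
  {X : ℕ → V → Fin K → Ω → ℝ} {A : ℕ → V → Ω → Fin K}

theorem nHat_pos_of_follows {P : Matrix V V ℝ} (hP : P ∈ Matrix.rowStochastic ℝ V) {e : V → ℝ}
    {a : ℕ → V → Fin K} {x : ℕ → V → ℝ} (h : FollowsConsensusUCB P ρ e a x) {t : ℕ} (ht : K ≤ t)
    (k : Fin K) (v : V) : 1 ≤ nHat P a k t v :=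
  one_le_nHat hP (j := k) (fun d => Fin.ext (h.init k k.2 d)) (k.2.trans_le ht) v

/-- During initialization an arm is pulled only in its own round, when its count is still 0. -/
theorem le_of_follows {P : Matrix V V ℝ} {e : V → ℝ} {a : ℕ → V → Fin K} {x : ℕ → V → ℝ}
    (h : FollowsConsensusUCB P ρ e a x) {t : ℕ} {v : V} {k : Fin K} (hk : a (t + 1) v = k)
    (hn : 0 < nHat P a k t v) : K ≤ t := by
  by_contra ht
  have ht : t < K := not_le.1 ht
  refine hn.ne' (nHat_eq_zero (fun i hi d hd => ?_) v)
  have h1 := h.init t ht v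
  have h2 := h.init i (hi.trans ht) d
  rw [hk, ← hd] at h1
  omega

theorem one_le_of_late_pull (hG : G.Connected) (hκ : 0 < κ)
    (hP : consensusMatrix G κ ∈ Matrix.rowStochastic ℝ V)
    (hu : IsOrderedEigenbasis (consensusMatrix G κ) lam u) {ω : Ω} (h : FollowsConsensusUCB (consensusMatrix G κ) ρ
      (agentEps lam u) (fun t v => A t v ω) (fun t v => X t v (A t v ω) ω))
    {k k₀ : Fin K} {Δ : ℝ} (hΔ : 0 < Δ) (hΔk : armMean ν k₀ - armMean ν k = Δ) (hρ0 : 0 < ρ)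
    {θ w η s c : ℝ} (hw : w = 6 * ρ / (Fintype.card V * Δ ^ 2)) (hc : 0 ≤ c) (hcw : c ^ 2 * θ = w)
    {v : V} (hs : s = w * θ ^ 2 * (η + agentEps lam u v) / η ^ 2) (hs1 : s < 1) (hη : 0 < η)
    {t : ℕ} (htθ : ((t + 1 : ℕ) : ℝ) ≤ θ ^ 3) (hθ : 0 < θ) (hA : A (t + 1) v ω = k)
    (hn : η ≤ nHat (consensusMatrix G κ) (fun t v => A t v ω) k t v) :
    1 ≤ deviation (consensusMatrix G κ) ν X A k₀ t v ω ^ 2 * (Fintype.card V /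
          (nHat (consensusMatrix G κ) (fun t v => A t v ω) k₀ t v + agentEps lam u v)) /
          (6 * ρ * ((t + 1 : ℕ) : ℝ) ^ (2 / 3 : ℝ)) +
        (deviation (consensusMatrix G κ) ν X A k t v ω /
          nHat (consensusMatrix G κ) (fun t v => A t v ω) k t v) ^ 2 /
          (Δ ^ 2 * (((1 - s) / 2) ^ 2 + 2 * ((1 - s) / 2) * c)) := by
  have he := agentEps_nonneg hG hκ hP hu v
  have hM : (0 : ℝ) < Fintype.card V := by
    have : Nonempty V := ⟨v⟩
    exact_mod_cast Fintype.card_pos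
  have ht := le_of_follows h hA (hη.trans_le hn)
  have hn₀ := nHat_pos_of_follows hP h ht k₀ v
  have hn₀t := nHat_le hP (fun t v => A t v ω) k₀ t v
  have hix := h.argmax t ht v k₀
  simp only [hA] at hix
  unfold ucbIndex at hix
  unfold deviation
  set e := agentEps lam u v
  set n := nHat (consensusMatrix G κ) (fun t v => A t v ω) k t v
  set n₀ := nHat (consensusMatrix G κ) (fun t v => A t v ω) k₀ t v
  set σ := sHat (consensusMatrix G κ) (fun t v => A t v ω) (fun t v => X t v (A t v ω) ω) k t v
  set σ₀ := sHat (consensusMatrix G κ) (fun t v => A t v ω) (fun t v => X t v (A t v ω) ω) k₀ t v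
  set τ := ((t + 1 : ℕ) : ℝ) ^ (1 / 3 : ℝ) with hτ
  have ht0 : (0 : ℝ) < ((t + 1 : ℕ) : ℝ) := by positivity
  have hτ0 : 0 < τ := Real.rpow_pos_of_pos ht0 _
  have hτ3 : τ ^ 3 = ((t + 1 : ℕ) : ℝ) := rpow_third_pow_three ht0.le
  have hτθ : τ ≤ θ := le_of_pow_le_pow_left₀ three_ne_zero hθ.le (by rw [hτ3]; exact htθ)
  rw [rpow_two_thirds ht0.le, ← hτ] at hix ⊢
  have hn0 : 0 < n := hη.trans_le hn
  have hn₀0 : 0 < n₀ := by linarith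
  have key := one_le_of_index_le (Δ := Δ) (D₀ := (σ₀ - armMean ν k₀ * n₀) / n₀)
    (C₀ := √(6 * ρ * τ ^ 2 / Fintype.card V * ((n₀ + e) / n₀ ^ 2)))
    (D₁ := (σ - armMean ν k * n) / n) (C₁ := √(6 * ρ * τ ^ 2 / Fintype.card V * ((n + e) / n ^ 2)))
    (s := s) (c := c) hΔ hs1 hc (Real.sqrt_pos.2 (by positivity)) ?_ ?_ ?_
  · refine key.trans (le_of_eq ?_)
    congr 1
    rw [Real.sq_sqrt (by positivity)]
    field_simp
  -- The bonus of the best arm is at least Δc whatever its count, because n₀ ≤ t ≤ τ³ ≤ τ²θ.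
  · refine Real.le_sqrt_of_sq_le ?_
    have h1 : (Δ * c) ^ 2 = 6 * ρ / Fintype.card V * (1 / θ) := by
      have : c ^ 2 = w / θ := by rw [← hcw]; field_simp
      rw [mul_pow, this, hw]
      field_simp
    have h2 : 6 * ρ * τ ^ 2 / Fintype.card V * ((n₀ + e) / n₀ ^ 2) =
        6 * ρ / Fintype.card V * (τ ^ 2 * (n₀ + e) / n₀ ^ 2) := by ring
    rw [h1, h2]
    refine mul_le_mul_of_nonneg_left ?_ (by positivity)
    rw [div_le_div_iff₀ hθ (by positivity)]
    have h3 : n₀ ≤ τ ^ 3 := by rw [hτ3]; push_cast; linarith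
    have h4 : n₀ ≤ τ ^ 2 * θ := h3.trans (by nlinarith [sq_nonneg τ])
    nlinarith [mul_nonneg (mul_nonneg (sq_nonneg τ) he) hθ.le]
  -- The bonus of the suboptimal arm is largest at time θ³ and count η, since (n + e)/n² decreases
  -- in n.
  · rw [Real.sq_sqrt (by positivity), hs, hw]
    have h1 : 6 * ρ * τ ^ 2 / Fintype.card V * ((n + e) / n ^ 2) =
        6 * ρ / Fintype.card V * (τ ^ 2 * ((n + e) / n ^ 2)) := by ring
    have h2 : Δ ^ 2 * (6 * ρ / (Fintype.card V * Δ ^ 2) * θ ^ 2 * (η + e) / η ^ 2) =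
        6 * ρ / Fintype.card V * (θ ^ 2 * ((η + e) / η ^ 2)) := by field_simp
    rw [h1, h2]
    refine mul_le_mul_of_nonneg_left (mul_le_mul (pow_le_pow_left₀ hτ0.le hτθ 2) ?_
      (by positivity) (by positivity)) (by positivity)
    rw [div_le_div_iff₀ (by positivity) (by positivity)]
    nlinarith [mul_nonneg he (sub_nonneg.2 (mul_le_mul hn hn hη.le hn0.le)),
      mul_nonneg (mul_nonneg hη.le hn0.le) (sub_nonneg.2 hn)]
  · have e0 : (σ₀ - armMean ν k₀ * n₀) / n₀ = σ₀ / n₀ - armMean ν k₀ := by field_simp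
    have e1 : (σ - armMean ν k * n) / n = σ / n - armMean ν k := by field_simp
    rw [e0, e1]
    linarith

end LatePulls

/-! ### Regret as expected pulls weighted by gaps -/

section RegretDecomposition

variable {V Ω : Type*} [Fintype V] {mΩ : MeasurableSpace Ω} {K : ℕ} {ν : Fin K → Measure ℝ}
  {μ : Measure Ω} {ℱ : Filtration ℕ mΩ} {X : ℕ → V → Fin K → Ω → ℝ} {A : ℕ → V → Ω → Fin K}

theorem measurable_totalPulls (hXA : IsBanditProcess μ ν ℱ X A) (k : Fin K) (T : ℕ) :
    Measurable fun ω => totalPulls (fun t v => A t v ω) k T :=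
  Finset.measurable_sum _ fun i _ => Finset.measurable_sum _ fun d _ =>
    (hXA.measurable_pullVec k i d).mono (ℱ.le i) le_rfl

variable [IsProbabilityMeasure μ]

theorem integrable_totalPulls (hXA : IsBanditProcess μ ν ℱ X A) (k : Fin K) (T : ℕ) :
    Integrable (fun ω => totalPulls (fun t v => A t v ω) k T) μ := by
  refine integrable_of_bounded (measurable_totalPulls hXA k T) (B := T * Fintype.card V)
    fun ω => ?_
  rw [totalPulls, abs_of_nonneg (Finset.sum_nonneg fun i _ => Finset.sum_nonneg fun d _ =>
    pullVec_nonneg _ k _ d)]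
  refine (Finset.sum_le_card_nsmul _ _ (Fintype.card V : ℝ) fun i _ => ?_).trans
    (by rw [Finset.card_range, nsmul_eq_mul])
  exact (Finset.sum_le_card_nsmul _ _ (1 : ℝ) fun d _ => pullVec_le_one _ k _ d).trans
    (by rw [Finset.card_univ, nsmul_eq_mul, mul_one])

theorem groupRegret_eq (hXA : IsBanditProcess μ ν ℱ X A) (T : ℕ) :
    groupRegret μ ν A T = ∑ k, gap ν k * ∫ ω, totalPulls (fun t v => A t v ω) k T ∂μ := by
  have hone : ∀ t v ω, ∑ k, pullVec (fun t v => A t v ω) k t v = 1 := fun t v ω => by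
    simp [pullVec]
  have hmean : ∀ t v ω, armMean ν (A t v ω) =
      ∑ k, armMean ν k * pullVec (fun t v => A t v ω) k t v := fun t v ω => by
    simp [pullVec]
  have hIcc : ∀ f : ℕ → ℝ, ∑ t ∈ Finset.Icc 1 T, f t = ∑ i ∈ Finset.range T, f (i + 1) := fun f => by
    rw [Finset.range_eq_Ico, Finset.sum_Ico_add' f 0 T 1]
    rfl
  have hsum : ∀ ω, ∑ v, ∑ t ∈ Finset.Icc 1 T, armMean ν (A t v ω) =
      ∑ k, armMean ν k * totalPulls (fun t v => A t v ω) k T := fun ω => by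
    simp only [hIcc, totalPulls, Finset.mul_sum]
    rw [Finset.sum_comm, Finset.sum_comm (s := (Finset.univ : Finset (Fin K)))]
    refine Finset.sum_congr rfl fun i _ => ?_
    rw [Finset.sum_comm (s := (Finset.univ : Finset (Fin K)))]
    exact Finset.sum_congr rfl fun v _ => hmean _ v ω
  have htot : ∑ k, ∫ ω, totalPulls (fun t v => A t v ω) k T ∂μ = T * Fintype.card V := by
    rw [← integral_finsetSum _ fun k _ => integrable_totalPulls hXA k T]
    have : ∀ ω, ∑ k, totalPulls (fun t v => A t v ω) k T = T * Fintype.card V := fun ω => by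
      simp only [totalPulls]
      rw [Finset.sum_comm]
      have : ∀ i, ∑ k, ∑ d, pullVec (fun t v => A t v ω) k (i + 1) d = Fintype.card V := fun i => by
        rw [Finset.sum_comm]
        simp only [hone, Finset.sum_const, Finset.card_univ, nsmul_eq_mul, mul_one]
      simp only [this, Finset.sum_const, Finset.card_range, nsmul_eq_mul]
    simp [this]
  rw [groupRegret, mul_assoc, ← htot, Finset.mul_sum]
  simp only [hsum]
  rw [integral_finsetSum _ fun k _ => (integrable_totalPulls hXA k T).const_mul _,
    ← Finset.sum_sub_distrib]
  refine Finset.sum_congr rfl fun k _ => ?_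
  rw [integral_const_mul, gap]
  ring

end RegretDecomposition

/-! ### Early pulls, late pulls and their sum -/

section ExpectedPulls

variable {V Ω : Type*} [Fintype V] [DecidableEq V] {mΩ : MeasurableSpace Ω}
  {G : SimpleGraph V} [DecidableRel G.Adj] {κ : ℝ} {lam : Fin (Fintype.card V) → ℝ}
  {u : OrthonormalBasis (Fin (Fintype.card V)) ℝ (EuclideanSpace ℝ V)}
  {K : ℕ} {ν : Fin K → Measure ℝ} {ρ : ℝ} {μ : Measure Ω} {ℱ : Filtration ℕ mΩ}
  {X : ℕ → V → Fin K → Ω → ℝ} {A : ℕ → V → Ω → Fin K}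

/-- Pulls made while the own consensus count is below a threshold are few. -/
theorem sum_early_pulls_le (hG : G.Connected) (hκ : 0 < κ)
    (hP : consensusMatrix G κ ∈ Matrix.rowStochastic ℝ V)
    (hu : IsOrderedEigenbasis (consensusMatrix G κ) lam u) (a : ℕ → V → Fin K) (k : Fin K)
    {η : ℝ} (hη : 0 ≤ η) (T : ℕ) :
    ∑ t ∈ Finset.range T, ∑ d, (if nHat (consensusMatrix G κ) a k t d < η then
        pullVec a k (t + 1) d else 0) ≤
      Fintype.card V * (η + epsGraph (V := V) lam) + Fintype.card V := by
  have hε := epsGraph_nonneg hG hκ hP hu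
  -- The induction also carries that early pulls are at most all pulls. If some agent is below η,
  -- the total so far is at most M(η + ε), and the round adds at most M.
  suffices h : ∀ n : ℕ, ∑ t ∈ Finset.range n, ∑ d, (if nHat (consensusMatrix G κ) a k t d < η then
        pullVec a k (t + 1) d else 0) ≤
      Fintype.card V * (η + epsGraph (V := V) lam) + Fintype.card V ∧
      ∑ t ∈ Finset.range n, ∑ d, (if nHat (consensusMatrix G κ) a k t d < η then
        pullVec a k (t + 1) d else 0) ≤ totalPulls a k n from (h T).1
  intro n
  induction n with
  | zero => simpa [totalPulls] using by positivity
  | succ n ih =>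
    obtain ⟨ih1, ih2⟩ := ih
    rw [Finset.sum_range_succ, totalPulls, Finset.sum_range_succ]
    refine ⟨?_, add_le_add ih2 (Finset.sum_le_sum fun d _ => ?_)⟩
    · by_cases hd : ∃ d, nHat (consensusMatrix G κ) a k n d < η
      · obtain ⟨d, hd⟩ := hd
        have hM : (0 : ℝ) < Fintype.card V := by
          have : Nonempty V := ⟨d⟩
          exact_mod_cast Fintype.card_pos
        have h1 := (abs_le.1 (abs_nHat_sub_le hG hκ hP hu a k n d)).1
        have h2 : totalPulls a k n / Fintype.card V ≤ η + epsGraph (V := V) lam := by linarith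
        rw [div_le_iff₀ hM, mul_comm] at h2
        refine add_le_add (ih2.trans h2) ?_
        refine (Finset.sum_le_card_nsmul _ _ (1 : ℝ) fun d _ => ?_).trans
          (by rw [Finset.card_univ, nsmul_eq_mul, mul_one])
        split_ifs
        · exact pullVec_le_one a k _ d
        · exact zero_le_one
      · rw [Finset.sum_eq_zero fun d _ => if_neg fun h => hd ⟨d, h⟩, add_zero]
        exact ih1
    · split_ifs
      · exact le_rfl
      · exact pullVec_nonneg a k _ d

theorem sum_late_pulls_eq {P : Matrix V V ℝ} (hP : P ∈ Matrix.rowStochastic ℝ V)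
    (a : ℕ → V → Fin K) (k : Fin K) (v : V) (η : ℝ) (T : ℕ) :
    ∑ t ∈ Finset.range T, (if η ≤ nHat P a k t v then pullVec a k (t + 1) v else 0) =
      ∑ t ∈ Finset.Ico ⌈η⌉₊ T, (if η ≤ nHat P a k t v then pullVec a k (t + 1) v else 0) := by
  symm
  refine Finset.sum_subset (fun t ht => Finset.mem_range.2 (Finset.mem_Ico.1 ht).2)
    fun t ht ht' => if_neg fun h => ht' ?_
  exact Finset.mem_Ico.2 ⟨Nat.ceil_le.2 (h.trans (nHat_le hP a k t v)), Finset.mem_range.1 ht⟩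

variable [∀ k, IsProbabilityMeasure (ν k)] [IsProbabilityMeasure μ]

/-- The indicator of a late pull is dominated almost surely by the two normalized squared
deviations, whose expectations are known. -/
theorem exists_late_pull_bound (hG : G.Connected) (hκ : 0 < κ)
    (hP : consensusMatrix G κ ∈ Matrix.rowStochastic ℝ V)
    (hu : IsOrderedEigenbasis (consensusMatrix G κ) lam u) (hXA : IsBanditProcess μ ν ℱ X A)
    (hν : ∀ k, MemLp id 2 (ν k)) (hρ : ∀ k, ∫ y, (y - armMean ν k) ^ 2 ∂(ν k) ≤ ρ) (hρ0 : 0 ≤ ρ)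
    (halg : ∀ᵐ ω ∂μ, FollowsConsensusUCB (consensusMatrix G κ) ρ
      (agentEps lam u) (fun t v => A t v ω) (fun t v => X t v (A t v ω) ω))
    {k k₀ : Fin K} {Δ : ℝ} (hΔ : 0 < Δ) (hΔk : armMean ν k₀ - armMean ν k = Δ)
    {θ w η s c : ℝ} (hw : w = 6 * ρ / (Fintype.card V * Δ ^ 2)) (hc : 0 ≤ c) (hcw : c ^ 2 * θ = w)
    {v : V} (hs : s = w * θ ^ 2 * (η + agentEps lam u v) / η ^ 2) (hs1 : s < 1) (hη : 0 < η)
    {t : ℕ} (htθ : ((t + 1 : ℕ) : ℝ) ≤ θ ^ 3) (hθ : 0 < θ) (hηt : η ≤ t) :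
    ∃ Y : Ω → ℝ, Integrable Y μ ∧
      ∫ ω, Y ω ∂μ ≤ (1 + Real.log t) / (6 * ((t : ℝ) + 1) ^ (2 / 3 : ℝ)) +
        (2 - η / θ ^ 3) * s / (6 * θ ^ 2 * (((1 - s) / 2) ^ 2 + 2 * ((1 - s) / 2) * c)) ∧
      ∀ᵐ ω ∂μ, (if η ≤ nHat (consensusMatrix G κ) (fun t v => A t v ω) k t v then
        pullVec (fun t v => A t v ω) k (t + 1) v else 0) ≤ Y ω := by
  have he := agentEps_nonneg hG hκ hP hu v
  have hM : (0 : ℝ) < Fintype.card V := by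
    have : Nonempty V := ⟨v⟩
    exact_mod_cast Fintype.card_pos
  have ht : 1 ≤ t := by
    have : (0 : ℝ) < t := hη.trans_le hηt
    exact_mod_cast this
  have ht0 : (1 : ℝ) ≤ t := by exact_mod_cast ht
  have hlog := Real.log_nonneg ht0
  obtain ⟨Y₀, hY₀i, hY₀0, hY₀, hY₀b⟩ :=
    exists_deviation_bound_log hG hκ hP hu hXA hν hρ hρ0 k₀ ht v
  obtain ⟨Y₁, hY₁i, hY₁0, hY₁, hY₁b⟩ :=
    exists_deviation_bound_const hG hκ hP hu hXA hν hρ hρ0 k v hη hηt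
  -- If ρ = 0, the bonus vanishes and cannot be divided by; but the deviations vanish almost surely,
  -- the indices are the true means, and a suboptimal arm is never pulled late.
  rcases hρ0.eq_or_lt with hρz | hρpos
  · have hw0 : w = 0 := by rw [hw, ← hρz]; simp
    have hs0 : s = 0 := by rw [hs, hw0]; simp
    refine ⟨fun _ => 0, integrable_zero _ _ _, ?_, ?_⟩
    · rw [hs0]
      simp only [integral_zero, mul_zero, zero_div, add_zero]
      positivity
    rw [← hρz, zero_mul] at hY₀
    rw [← hρz, zero_mul, mul_zero] at hY₁
    have hz₀ := (integral_eq_zero_iff_of_nonneg hY₀0 hY₀i).1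
      (le_antisymm hY₀ (integral_nonneg hY₀0))
    have hz₁ := (integral_eq_zero_iff_of_nonneg hY₁0 hY₁i).1
      (le_antisymm hY₁ (integral_nonneg hY₁0))
    filter_upwards [halg, hz₀, hz₁] with ω h h₀ h₁
    split_ifs with hn
    swap
    · exact le_rfl
    rcases pullVec_eq (fun t v => A t v ω) k (t + 1) v with hp | hp
    · exact hp.le
    exfalso
    have hA : A (t + 1) v ω = k := by
      by_contra hA
      simp [pullVec, hA] at hp
    have hK := le_of_follows h hA (hη.trans_le hn)
    have hn₀ := nHat_pos_of_follows hP h hK k₀ v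
    have b₀ := hY₀b ω hn₀
    have b₁ := hY₁b ω hn
    rw [h₀] at b₀
    rw [h₁] at b₁
    have hix := h.argmax t hK v k₀
    simp only [hA] at hix
    unfold ucbIndex at hix
    unfold deviation at b₀ b₁
    rw [← hρz] at hix
    simp only [mul_zero, zero_mul, zero_div, Real.sqrt_zero, add_zero] at hix
    set e := agentEps lam u v
    set n := nHat (consensusMatrix G κ) (fun t v => A t v ω) k t v
    set n₀ := nHat (consensusMatrix G κ) (fun t v => A t v ω) k₀ t v
    set σ := sHat (consensusMatrix G κ) (fun t v => A t v ω) (fun t v => X t v (A t v ω) ω) k t v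
    set σ₀ := sHat (consensusMatrix G κ) (fun t v => A t v ω) (fun t v => X t v (A t v ω) ω) k₀ t v
    have hn0 : 0 < n := hη.trans_le hn
    have hn₀0 : 0 < n₀ := by linarith
    have hq : 0 < Fintype.card V / (n₀ + e) := by positivity
    have c₀ : σ₀ - armMean ν k₀ * n₀ = 0 := by
      by_contra hne
      have := mul_pos (sq_pos_of_ne_zero hne) hq
      exact absurd b₀ (not_le.2 this)
    have c₁ : (σ - armMean ν k * n) / n = 0 := by
      by_contra hne
      exact absurd b₁ (not_le.2 (sq_pos_of_ne_zero hne))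
    have e0 : σ₀ / n₀ = armMean ν k₀ := by rw [div_eq_iff hn₀0.ne']; linarith
    have e1 : (σ - armMean ν k * n) / n = σ / n - armMean ν k := by field_simp
    rw [e0] at hix
    rw [e1] at c₁
    linarith
  · set q := ((1 - s) / 2) ^ 2 + 2 * ((1 - s) / 2) * c with hq
    have hq0 : 0 < q := by
      have : 0 < (1 - s) / 2 := by linarith
      positivity
    refine ⟨fun ω => Y₀ ω / (6 * ρ * ((t + 1 : ℕ) : ℝ) ^ (2 / 3 : ℝ)) + Y₁ ω / (Δ ^ 2 * q),
      (hY₀i.div_const _).add (hY₁i.div_const _), ?_, ?_⟩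
    · rw [integral_add (hY₀i.div_const _) (hY₁i.div_const _), integral_div, integral_div]
      refine add_le_add ?_ ?_
      · refine (div_le_div_of_nonneg_right hY₀ (by positivity)).trans (le_of_eq ?_)
        push_cast
        field_simp
      · refine (div_le_div_of_nonneg_right hY₁ (by positivity)).trans ?_
        -- Here ρ disappears: ρ(η + e)/(MΔ²η²) = s/(6θ²).
        have h1 : (η + agentEps lam u v) / (Fintype.card V * η ^ 2) * (ρ * (2 - η / t)) /
            (Δ ^ 2 * q) = (2 - η / t) * s / (6 * θ ^ 2 * q) := by
          rw [hs, hw]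
          field_simp
        rw [h1]
        have hs0 : 0 ≤ s := by
          rw [hs, hw]; positivity
        refine div_le_div_of_nonneg_right (mul_le_mul_of_nonneg_right (sub_le_sub_left ?_ _) hs0)
          (by positivity)
        refine div_le_div_of_nonneg_left hη.le (by linarith) ?_
        push_cast at htθ
        linarith
    · filter_upwards [halg] with ω h
      have hpos : 0 ≤ Y₀ ω / (6 * ρ * ((t + 1 : ℕ) : ℝ) ^ (2 / 3 : ℝ)) + Y₁ ω / (Δ ^ 2 * q) :=
        add_nonneg (div_nonneg (hY₀0 ω) (by positivity)) (div_nonneg (hY₁0 ω) (by positivity))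
      split_ifs with hn
      swap
      · exact hpos
      rcases pullVec_eq (fun t v => A t v ω) k (t + 1) v with hp | hp
      · rw [hp]; exact hpos
      rw [hp]
      have hA : A (t + 1) v ω = k := by
        by_contra hA
        simp [pullVec, hA] at hp
      have hK := le_of_follows h hA (hη.trans_le hn)
      refine (one_le_of_late_pull hG hκ hP hu h hΔ hΔk hρpos hw hc hcw hs hs1 hη htθ hθ hA
        hn).trans (add_le_add (div_le_div_of_nonneg_right (hY₀b ω
          (nHat_pos_of_follows hP h hK k₀ v)) (by positivity))
          (div_le_div_of_nonneg_right (hY₁b ω hn) (by positivity)))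

theorem exists_late_pulls_bound (hG : G.Connected) (hκ : 0 < κ)
    (hP : consensusMatrix G κ ∈ Matrix.rowStochastic ℝ V)
    (hu : IsOrderedEigenbasis (consensusMatrix G κ) lam u) (hXA : IsBanditProcess μ ν ℱ X A)
    (hν : ∀ k, MemLp id 2 (ν k)) (hρ : ∀ k, ∫ y, (y - armMean ν k) ^ 2 ∂(ν k) ≤ ρ) (hρ0 : 0 ≤ ρ)
    (halg : ∀ᵐ ω ∂μ, FollowsConsensusUCB (consensusMatrix G κ) ρ
      (agentEps lam u) (fun t v => A t v ω) (fun t v => X t v (A t v ω) ω))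
    {k k₀ : Fin K} {Δ : ℝ} (hΔ : 0 < Δ) (hΔk : armMean ν k₀ - armMean ν k = Δ)
    {θ w η : ℝ} (hw : w = 6 * ρ / (Fintype.card V * Δ ^ 2)) {T : ℕ} (hT : θ ^ 3 = T) (hθ : 1 ≤ θ)
    (hη : η = (w + thresholdShare θ) * θ ^ 2) (v : V) :
    ∃ Y : Ω → ℝ, Integrable Y μ ∧
      ∫ ω, Y ω ∂μ ≤ θ ^ 2 * (1 - thresholdShare θ) + w * θ ^ 2 * agentEps lam u v ∧
      ∀ᵐ ω ∂μ, ∑ t ∈ Finset.range T,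
        (if η ≤ nHat (consensusMatrix G κ) (fun t v => A t v ω) k t v then
          pullVec (fun t v => A t v ω) k (t + 1) v else 0) ≤ Y ω := by
  have he := agentEps_nonneg hG hκ hP hu v
  have hM : (0 : ℝ) < Fintype.card V := by
    have : Nonempty V := ⟨v⟩
    exact_mod_cast Fintype.card_pos
  have hθ0 : 0 < θ := by linarith
  have hw0 : 0 ≤ w := by rw [hw]; positivity
  have hb := thresholdShare_pos θ
  have hb1 := thresholdShare_lt_one θ
  have hη0 : 0 < η := by rw [hη]; positivity
  set e := agentEps lam u v with hedef
  have hceil : η ≤ (⌈η⌉₊ : ℝ) := Nat.le_ceil η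
  simp only [sum_late_pulls_eq hP]
  have hbound : 0 ≤ θ ^ 2 * (1 - thresholdShare θ) + w * θ ^ 2 * e :=
    add_nonneg (mul_nonneg (sq_nonneg _) (by linarith)) (by positivity)
  -- Otherwise θ - w ≤ 1 + w e, and the trivial bound T - ⌈η⌉ on the late rounds already fits the
  -- budget.
  by_cases hsmall : w * e < θ - 1 - w
  · set c := √(w / θ) with hc
    have hcw : c ^ 2 * θ = w := by rw [hc, Real.sq_sqrt (by positivity)]; field_simp
    set s := w * θ ^ 2 * (η + e) / η ^ 2 with hs
    obtain ⟨hs1, hηT, hbud⟩ := late_budget hθ hw0 he (Real.sqrt_nonneg _) hcw hsmall hη hs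
    have hs0 : 0 ≤ s := by rw [hs]; positivity
    set D := (2 - η / θ ^ 3) * s / (6 * θ ^ 2 * (((1 - s) / 2) ^ 2 + 2 * ((1 - s) / 2) * c)) with hD
    have hy : η / θ ^ 3 ≤ 1 := by rw [div_le_one (by positivity)]; exact hηT
    have hD0 : 0 ≤ D := by
      have h1 : 0 < (1 - s) / 2 := by linarith
      exact div_nonneg (mul_nonneg (by linarith) hs0) (by positivity)
    have hex : ∀ t ∈ Finset.Ico ⌈η⌉₊ T, ∃ Y : Ω → ℝ, Integrable Y μ ∧
      ∫ ω, Y ω ∂μ ≤ (1 + Real.log t) / (6 * ((t : ℝ) + 1) ^ (2 / 3 : ℝ)) + D ∧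
      ∀ᵐ ω ∂μ, (if η ≤ nHat (consensusMatrix G κ) (fun t v => A t v ω) k t v then
        pullVec (fun t v => A t v ω) k (t + 1) v else 0) ≤ Y ω := fun t ht => by
      obtain ⟨h1, h2⟩ := Finset.mem_Ico.1 ht
      refine exists_late_pull_bound hG hκ hP hu hXA hν hρ hρ0 halg hΔ hΔk hw (Real.sqrt_nonneg _)
        hcw hs hs1 hη0 ?_ hθ0 (Nat.ceil_le.1 h1)
      rw [hT]
      exact_mod_cast h2
    choose! Y hYi hY hYb using hex
    refine ⟨fun ω => ∑ t ∈ Finset.Ico ⌈η⌉₊ T, Y t ω, integrable_finsetSum _ hYi, ?_, ?_⟩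
    · rw [integral_finsetSum _ hYi]
      refine le_trans ?_ hbud
      have h1 : ∑ t ∈ Finset.Ico ⌈η⌉₊ T, ∫ ω, Y t ω ∂μ ≤ ∑ t ∈ Finset.Ico ⌈η⌉₊ T,
          (0.39 * (((t + 1 : ℕ) : ℝ) ^ (2 / 3 : ℝ) - (t : ℝ) ^ (2 / 3 : ℝ)) + D) := by
        refine Finset.sum_le_sum fun t ht => (hY t ht).trans (add_le_add ?_ le_rfl)
        have h2 : (1 : ℝ) ≤ t := by
          have h3 : 0 < ⌈η⌉₊ := Nat.ceil_pos.2 hη0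
          have := (Finset.mem_Ico.1 ht).1
          exact_mod_cast h3.trans_le this
        push_cast
        exact one_add_log_div_le h2
      refine h1.trans ?_
      have hcT : ⌈η⌉₊ ≤ T := Nat.ceil_le.2 (by rw [← hT]; exact hηT)
      rw [Finset.sum_add_distrib, ← Finset.mul_sum, Finset.sum_Ico_sub
        (fun t : ℕ => (t : ℝ) ^ (2 / 3 : ℝ)) hcT, Finset.sum_const, Nat.card_Ico, nsmul_eq_mul,
        Nat.cast_sub hcT, ← hT]
      have h3 : (θ ^ 3) ^ (2 / 3 : ℝ) = θ ^ 2 := by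
        rw [← Real.rpow_natCast θ 3, ← Real.rpow_mul hθ0.le, ← Real.rpow_natCast θ 2]
        norm_num
      have h4 : η ^ (2 / 3 : ℝ) ≤ (⌈η⌉₊ : ℝ) ^ (2 / 3 : ℝ) :=
        Real.rpow_le_rpow hη0.le hceil (by norm_num)
      rw [h3]
      refine add_le_add (mul_le_mul_of_nonneg_left (by linarith) (by norm_num))
        (mul_le_mul_of_nonneg_right (by linarith) hD0)
    · have hall : ∀ᵐ ω ∂μ, ∀ t ∈ Finset.Ico ⌈η⌉₊ T,
          (if η ≤ nHat (consensusMatrix G κ) (fun t v => A t v ω) k t v then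
            pullVec (fun t v => A t v ω) k (t + 1) v else 0) ≤ Y t ω :=
        (Finset.eventually_all _).2 hYb
      filter_upwards [hall] with ω h
      exact Finset.sum_le_sum h
  · refine ⟨fun _ => θ ^ 2 * (1 - thresholdShare θ) + w * θ ^ 2 * e, integrable_const _, by simp,
      Filter.Eventually.of_forall fun ω => ?_⟩
    refine (Finset.sum_le_card_nsmul _ _ (1 : ℝ) fun t _ => ?_).trans ?_
    · split_ifs
      · exact pullVec_le_one _ k _ v
      · exact zero_le_one
    rw [Nat.card_Ico, nsmul_eq_mul, mul_one]
    rcases le_total T ⌈η⌉₊ with h | h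
    · rw [Nat.sub_eq_zero_of_le h]
      simpa using hbound
    · rw [Nat.cast_sub h, ← hT]
      have hceil' : (w + thresholdShare θ) * θ ^ 2 ≤ (⌈η⌉₊ : ℝ) := hη.symm.trans_le hceil
      show θ ^ 3 - (⌈η⌉₊ : ℝ) ≤ θ ^ 2 * (1 - thresholdShare θ) + w * θ ^ 2 * e
      nlinarith [mul_le_mul_of_nonneg_left (not_lt.1 hsmall) (sq_nonneg θ)]

/-- Expected number of pulls of an arm with positive gap. -/
theorem integral_totalPulls_le (hG : G.Connected) (hκ : 0 < κ)
    (hP : consensusMatrix G κ ∈ Matrix.rowStochastic ℝ V)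
    (hu : IsOrderedEigenbasis (consensusMatrix G κ) lam u) (hXA : IsBanditProcess μ ν ℱ X A)
    (hν : ∀ k, MemLp id 2 (ν k)) (hρ : ∀ k, ∫ y, (y - armMean ν k) ^ 2 ∂(ν k) ≤ ρ) (hρ0 : 0 ≤ ρ)
    (halg : ∀ᵐ ω ∂μ, FollowsConsensusUCB (consensusMatrix G κ) ρ
      (agentEps lam u) (fun t v => A t v ω) (fun t v => X t v (A t v ω) ω))
    {k k₀ : Fin K} {Δ : ℝ} (hΔ : 0 < Δ) (hΔk : armMean ν k₀ - armMean ν k = Δ) (T : ℕ) :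
    ∫ ω, totalPulls (fun t v => A t v ω) k T ∂μ ≤
      (Fintype.card V : ℝ) + (Fintype.card V : ℝ) * epsGraph (V := V) lam +
        (T : ℝ) ^ (2 / 3 : ℝ) * (6 * ρ * ((1 + hGraph lam u) / Δ ^ 2) + (Fintype.card V : ℝ)) := by
  have : Nonempty V := hG.nonempty
  have hM : (0 : ℝ) < Fintype.card V := by exact_mod_cast Fintype.card_pos
  have hh := hGraph_nonneg hG hκ hP hu
  have hε := epsGraph_nonneg hG hκ hP hu
  rcases Nat.eq_zero_or_pos T with rfl | hT
  · simp only [totalPulls, Finset.range_zero, Finset.sum_empty, integral_zero]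
    positivity
  have hT1 : (1 : ℝ) ≤ T := by exact_mod_cast hT
  have hT0 : (0 : ℝ) ≤ T := by linarith
  set θ := (T : ℝ) ^ (1 / 3 : ℝ) with hθdef
  have hθ : 1 ≤ θ := Real.one_le_rpow hT1 (by norm_num)
  have hθ3 : θ ^ 3 = T := rpow_third_pow_three hT0
  rw [rpow_two_thirds hT0, ← hθdef]
  set w := 6 * ρ / (Fintype.card V * Δ ^ 2) with hw
  set η := (w + thresholdShare θ) * θ ^ 2 with hη
  have hw0 : 0 ≤ w := by rw [hw]; positivity
  have hb := thresholdShare_pos θ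
  have hη0 : 0 ≤ η := by rw [hη]; positivity
  choose Y hYi hY hYb using fun v =>
    exists_late_pulls_bound hG hκ hP hu hXA hν hρ hρ0 halg hΔ hΔk hw hθ3 hθ hη v
  have hle : ∀ᵐ ω ∂μ, totalPulls (fun t v => A t v ω) k T ≤
      (Fintype.card V * (η + epsGraph (V := V) lam) + Fintype.card V) + ∑ v, Y v ω := by
    filter_upwards [Filter.eventually_all.2 hYb] with ω h
    have h1 := sum_early_pulls_le hG hκ hP hu (fun t v => A t v ω) k hη0 T
    have h2 := Finset.sum_le_sum fun v (_ : v ∈ Finset.univ) => h v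
    rw [Finset.sum_comm] at h2
    refine le_trans (le_of_eq ?_) (add_le_add h1 h2)
    rw [totalPulls, ← Finset.sum_add_distrib]
    refine Finset.sum_congr rfl fun t _ => ?_
    rw [← Finset.sum_add_distrib]
    refine Finset.sum_congr rfl fun d _ => ?_
    by_cases hn : nHat (consensusMatrix G κ) (fun t v => A t v ω) k t d < η
    · rw [if_pos hn, if_neg (not_le.2 hn), add_zero]
    · rw [if_neg hn, if_pos (not_lt.1 hn), zero_add]
  have hsum : Integrable (fun ω => ∑ v, Y v ω) μ := integrable_finsetSum _ fun v _ => hYi v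
  refine (integral_mono_ae (integrable_totalPulls hXA k T)
    ((integrable_const _).add hsum) hle).trans ?_
  have h3 : ∫ ω, (((Fintype.card V * (η + epsGraph (V := V) lam) + Fintype.card V : ℝ)) +
      ∑ v, Y v ω) ∂μ ≤ (Fintype.card V * (η + epsGraph (V := V) lam) + Fintype.card V) +
      ∑ v, (θ ^ 2 * (1 - thresholdShare θ) + w * θ ^ 2 * agentEps lam u v) := by
    rw [integral_add (integrable_const _) hsum, integral_finsetSum _ fun v _ => hYi v]
    refine add_le_add (by simp) (Finset.sum_le_sum fun v _ => hY v)
  -- The share b inside η and the 1 - b of the late pulls add up to exactly one M θ².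
  refine h3.trans (le_of_eq ?_)
  have h4 : ∑ v, agentEps lam u v = Fintype.card V * hGraph lam u := by
    rw [hGraph_eq_average, mul_div_cancel₀ _ hM.ne']
  have h5 : 6 * ρ * ((1 + hGraph lam u) / Δ ^ 2) = Fintype.card V * w * (1 + hGraph lam u) := by
    rw [hw]; field_simp
  rw [Finset.sum_add_distrib, ← Finset.mul_sum (f := agentEps lam u), h4, Finset.sum_const, Finset.card_univ,
    nsmul_eq_mul, h5, hη]
  ring

end ExpectedPulls

end ConsensusBandit

/-! ### The regret bounds -/

theorem mainTheorem3 {V Ω : Type*} [Fintype V] [DecidableEq V] [MeasurableSpace Ω]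
    (G : SimpleGraph V) [DecidableRel G.Adj] (hG : G.Connected)
    (κ : ℝ) (hκ : 0 < κ)
    (hP : ConsensusBandit.consensusMatrix G κ ∈ Matrix.rowStochastic ℝ V)
    (lam : Fin (Fintype.card V) → ℝ)
    (u : OrthonormalBasis (Fin (Fintype.card V)) ℝ (EuclideanSpace ℝ V))
    (hu : ConsensusBandit.IsOrderedEigenbasis (ConsensusBandit.consensusMatrix G κ) lam u)
    (K : ℕ) (ν : Fin K → Measure ℝ) [∀ k, IsProbabilityMeasure (ν k)] (ρ : ℝ)
    (hν : ∀ k, MemLp id 2 (ν k))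
    (hρ : ∀ k, ∫ y, (y - ConsensusBandit.armMean ν k) ^ 2 ∂(ν k) ≤ ρ)
    (μ : Measure Ω) [IsProbabilityMeasure μ] (ℱ : Filtration ℕ ‹MeasurableSpace Ω›)
    (X : ℕ → V → Fin K → Ω → ℝ) (A : ℕ → V → Ω → Fin K)
    (hXA : ConsensusBandit.IsBanditProcess μ ν ℱ X A)
    (halg : ∀ᵐ ω ∂μ, ConsensusBandit.FollowsConsensusUCB (ConsensusBandit.consensusMatrix G κ) ρ
      (ConsensusBandit.agentEps lam u) (fun t v => A t v ω) (fun t v => X t v (A t v ω) ω)) :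
    (∀ T : ℕ, ConsensusBandit.groupRegret μ ν A T ≤
      ∑ k, ConsensusBandit.gap ν k *
        ((Fintype.card V : ℝ) + (Fintype.card V : ℝ) * ConsensusBandit.epsGraph (V := V) lam +
          (T : ℝ) ^ (2 / 3 : ℝ) *
            (6 * ρ * ((1 + ConsensusBandit.hGraph lam u) / ConsensusBandit.gap ν k ^ 2) +
              (Fintype.card V : ℝ)))) ∧
    (∀ C : ℝ, 0 ≤ C →
      (∀ k, 0 < ConsensusBandit.gap ν k →
        6 * ρ / ConsensusBandit.gap ν k +
          2 * (Fintype.card V : ℝ) * ConsensusBandit.gap ν k ≤ C) →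
      ∀ T : ℕ, 1 + ConsensusBandit.epsGraph (V := V) lam ≤ (T : ℝ) ^ (2 / 3 : ℝ) →
        ConsensusBandit.groupRegret μ ν A T ≤
          C * (1 + ConsensusBandit.hGraph lam u) * K * (T : ℝ) ^ (2 / 3 : ℝ)) := by
  have hne : Nonempty V := hG.nonempty
  have hΩ : Nonempty Ω := μ.nonempty_of_neZero
  have hK : Nonempty (Fin K) := ⟨A 0 hne.some hΩ.some⟩
  have hM : (0 : ℝ) < Fintype.card V := by exact_mod_cast Fintype.card_pos
  have hρ0 : 0 ≤ ρ := (integral_nonneg fun y => sq_nonneg _).trans (hρ hK.some)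
  have hh := ConsensusBandit.hGraph_nonneg hG hκ hP hu
  have hε := ConsensusBandit.epsGraph_nonneg hG hκ hP hu
  have hgap : ∀ k, 0 ≤ ConsensusBandit.gap ν k := fun k =>
    sub_nonneg.2 (le_ciSup (Finite.bddAbove_range (ConsensusBandit.armMean ν)) k)
  obtain ⟨k₀, hk₀⟩ := exists_eq_ciSup_of_finite (f := ConsensusBandit.armMean ν)
  have hfirst : ∀ T : ℕ, ConsensusBandit.groupRegret μ ν A T ≤
      ∑ k, ConsensusBandit.gap ν k *
        ((Fintype.card V : ℝ) + (Fintype.card V : ℝ) * ConsensusBandit.epsGraph (V := V) lam +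
          (T : ℝ) ^ (2 / 3 : ℝ) *
            (6 * ρ * ((1 + ConsensusBandit.hGraph lam u) / ConsensusBandit.gap ν k ^ 2) +
              (Fintype.card V : ℝ))) := fun T => by
    rw [ConsensusBandit.groupRegret_eq hXA]
    refine Finset.sum_le_sum fun k _ => ?_
    rcases (hgap k).eq_or_lt with h0 | hpos
    -- Arms without gap contribute 0 on both sides, whatever the value of the division by Δ², so the
    -- sum may run over all arms.
    · rw [← h0, zero_mul, zero_mul]
    · exact mul_le_mul_of_nonneg_left (ConsensusBandit.integral_totalPulls_le hG hκ hP hu hXA hν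
        hρ hρ0 halg hpos (by rw [ConsensusBandit.gap, hk₀]) T) hpos.le
  refine ⟨hfirst, fun C hC hCk T hT => (hfirst T).trans ?_⟩
  set θ := (T : ℝ) ^ (2 / 3 : ℝ) with hθ
  set h := ConsensusBandit.hGraph lam u
  have hθ0 : 0 ≤ θ := by linarith
  have hterm : ∀ k ∈ (Finset.univ : Finset (Fin K)), ConsensusBandit.gap ν k *
      ((Fintype.card V : ℝ) + (Fintype.card V : ℝ) * ConsensusBandit.epsGraph (V := V) lam +
        θ * (6 * ρ * ((1 + h) / ConsensusBandit.gap ν k ^ 2) + (Fintype.card V : ℝ))) ≤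
      C * (1 + h) * θ := fun k _ => by
    rcases (hgap k).eq_or_lt with h0 | hpos
    · rw [← h0, zero_mul]
      positivity
    · have hCk := hCk k hpos
      set D := ConsensusBandit.gap ν k
      calc D * ((Fintype.card V : ℝ) + (Fintype.card V : ℝ) *
              ConsensusBandit.epsGraph (V := V) lam +
              θ * (6 * ρ * ((1 + h) / D ^ 2) + (Fintype.card V : ℝ)))
          = D * Fintype.card V * (1 + ConsensusBandit.epsGraph (V := V) lam) +
              θ * (6 * ρ / D * (1 + h) + D * Fintype.card V) := by field_simp
        -- The assumption on T absorbs 1 + ε into T^(2/3), which is θ here; this is the second of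
        -- the two terms MΔ in C.
        _ ≤ D * Fintype.card V * θ + θ * (6 * ρ / D * (1 + h) + D * Fintype.card V) :=
            add_le_add (mul_le_mul_of_nonneg_left hT (by positivity)) le_rfl
        _ = (6 * ρ / D * (1 + h) + 2 * Fintype.card V * D) * θ := by ring
        _ ≤ (6 * ρ / D * (1 + h) + 2 * Fintype.card V * D * (1 + h)) * θ :=
            mul_le_mul_of_nonneg_right (add_le_add le_rfl
              (le_mul_of_one_le_right (by positivity) (by linarith))) hθ0
        _ = (6 * ρ / D + 2 * Fintype.card V * D) * (1 + h) * θ := by ring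
        _ ≤ C * (1 + h) * θ := by gcongr
  refine (Finset.sum_le_card_nsmul _ _ _ hterm).trans (le_of_eq ?_)
  rw [Finset.card_univ, Fintype.card_fin, nsmul_eq_mul]
  ring
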